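/- Let $2=\{0,1\}$, let $2^{<\omega}$ be the set of finite words over $2$ (including the empty word), and, for a finite alphabet $Y$, give the set $Y^\omega$ of infinite words over $Y$ the product of the discrete topologies. The $\omega$-power of a language $L\subseteq 2^{<\omega}$ is the set $L^\infty\subseteq 2^\omega$ of all infinite words $\sigma=w_0w_1w_2\ldots$ with $w_i\in L$ for every $i\in\omega$. For a topological space $X$, let $\mathbf\Sigma^0_1(X)$ and $\mathbf\Pi^0_1(X)$ be the classes of open and of closed subsets of $X$; for a countable ordinal $\xi\ge 2$, let $\mathbf\Sigma^0_\xi(X)$ be the class of countable unions of sets in $\bigcup_{1\le\gamma<\xi}\mathbf\Pi^0_\gamma(X)$, and let $\mathbf\Pi^0_\xi(X)$ be the class of countable intersections of sets in $\bigcup_{1\le\gamma<\xi}\mathbf\Sigma^0_\gamma(X)$. For $\mathbf\Gamma$ one of these classes, a set $C\subseteq 2^\omega$ is $\mathbf\Gamma$-complete if $C\in\mathbf\Gamma(2^\omega)$ and if for every finite alphabet $Y$ and every $A\in\mathbf\Gamma(Y^\omega)$ there is a continuous map $f:Y^\omega\to 2^\omega$ with $A=f^{-1}(C)$. Theorem.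 Let $\xi\ge 1$ be a countable ordinal. (a) There is a language $P_\xi\subseteq 2^{<\omega}$ whose $\omega$-power $P_\xi^\infty$ is $\mathbf\Pi^0_\xi$-complete. (b) There is a language $S_\xi\subseteq 2^{<\omega}$ whose $\omega$-power $S_\xi^\infty$ is $\mathbf\Sigma^0_\xi$-complete. -/

import Mathlib

/-- The additive Borel classes `Σ⁰_ξ(X)`, `ξ ≥ 1`, of a topological space `X`:
`Σ⁰_1` is the class of open sets and, for `ξ ≥ 2`, `Σ⁰_ξ` is the class of countable unions
of sets `s n` in `⋃_{1 ≤ γ < ξ} Π⁰_γ`, a set being in `Π⁰_γ` when its complement is in `Σ⁰_γ`.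
(No set is in `Σ⁰_0`.) -/
inductive IsSigma0 {X : Type} [TopologicalSpace X] : Ordinal.{0} → Set X → Prop
  | of_isOpen (s : Set X) (hs : IsOpen s) : IsSigma0 1 s
  | iUnion (ξ : Ordinal.{0}) (hξ : 2 ≤ ξ) (γ : ℕ → Ordinal.{0}) (s : ℕ → Set X)
      (h1 : ∀ n, 1 ≤ γ n) (hlt : ∀ n, γ n < ξ) (hs : ∀ n, IsSigma0 (γ n) (s n)ᶜ) :
      IsSigma0 ξ (⋃ n, s n)

/-- The multiplicative Borel classes `Π⁰_ξ(X)`: the complements of the `Σ⁰_ξ` sets. -/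
def IsPi0 {X : Type} [TopologicalSpace X] (ξ : Ordinal.{0}) (s : Set X) : Prop :=
  IsSigma0 ξ sᶜ

theorem isSigma0_one_iff {X : Type} [TopologicalSpace X] (s : Set X) :
    IsSigma0 1 s ↔ IsOpen s := by
  constructor
  · intro h
    generalize hξ : (1 : Ordinal.{0}) = ξ at h
    cases h with
    | of_isOpen _ hs => exact hs
    | iUnion _ h2 _ _ _ _ _ =>
      subst hξ
      exact absurd h2 (not_le.mpr (by exact_mod_cast Nat.one_lt_two))
  · exact IsSigma0.of_isOpen s

theorem isPi0_one_iff {X : Type} [TopologicalSpace X] (s : Set X) :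
    IsPi0 1 s ↔ IsClosed s := by
  rw [IsPi0, isSigma0_one_iff, isOpen_compl_iff]

theorem isSigma0_iff {X : Type} [TopologicalSpace X] {ξ : Ordinal.{0}} (hξ : 2 ≤ ξ) (t : Set X) :
    IsSigma0 ξ t ↔ ∃ (γ : ℕ → Ordinal.{0}) (s : ℕ → Set X),
      (∀ n, 1 ≤ γ n ∧ γ n < ξ ∧ IsPi0 (γ n) (s n)) ∧ t = ⋃ n, s n := by
  constructor
  · intro h
    cases h with
    | of_isOpen _ hs => exact absurd hξ (not_le.mpr (by exact_mod_cast Nat.one_lt_two))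
    | iUnion _ h2 γ s h1 hlt hs => exact ⟨γ, s, fun n => ⟨h1 n, hlt n, hs n⟩, rfl⟩
  · rintro ⟨γ, s, h, rfl⟩
    exact IsSigma0.iUnion ξ hξ γ s (fun n => (h n).1) (fun n => (h n).2.1) (fun n => (h n).2.2)

theorem isPi0_iff {X : Type} [TopologicalSpace X] {ξ : Ordinal.{0}} (hξ : 2 ≤ ξ) (t : Set X) :
    IsPi0 ξ t ↔ ∃ (γ : ℕ → Ordinal.{0}) (s : ℕ → Set X),
      (∀ n, 1 ≤ γ n ∧ γ n < ξ ∧ IsSigma0 (γ n) (s n)) ∧ t = ⋂ n, s n := by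
  rw [IsPi0, isSigma0_iff hξ]
  constructor
  · rintro ⟨γ, s, h, ht⟩
    refine ⟨γ, fun n => (s n)ᶜ, h, ?_⟩
    rw [← Set.compl_iUnion, ← ht, compl_compl]
  · rintro ⟨γ, s, h, rfl⟩
    refine ⟨γ, fun n => (s n)ᶜ, fun n => ⟨(h n).1, (h n).2.1, ?_⟩, Set.compl_iInter s⟩
    rw [IsPi0, compl_compl]
    exact (h n).2.2

/-- `A ⊆ X` is Wadge reducible to `C ⊆ Z`: it is the preimage of `C` under a continuous map. -/
def IsWadgeReducible {X Z : Type} [TopologicalSpace X] [TopologicalSpace Z]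
    (A : Set X) (C : Set Z) : Prop :=
  ∃ f : X → Z, Continuous f ∧ A = f ⁻¹' C

/-- `C ⊆ Z` is complete for the class of sets `Γ`: `C` is in `Γ(Z)`, and `C` is `Γ`-hard, i.e.
for every finite alphabet `Y` every `Γ` subset of `Y^ω` is Wadge reducible to `C`. Here `Y` is
discrete and `Y^ω = (ℕ → Y)` has the product topology. -/
def IsCompleteFor (Γ : ∀ (X : Type) [TopologicalSpace X], Set X → Prop)
    {Z : Type} [TopologicalSpace Z] (C : Set Z) : Prop :=
  Γ Z C ∧
    ∀ (Y : Type) [Finite Y] [TopologicalSpace Y] [DiscreteTopology Y] (A : Set (ℕ → Y)),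
      Γ (ℕ → Y) A → IsWadgeReducible A C

/-- The concatenation `w 0 ⌢ w 1 ⌢ ⋯ ⌢ w (n - 1)`. -/
def concatFirst {α : Type} (w : ℕ → List α) (n : ℕ) : List α :=
  ((List.range n).map w).flatten

/-- The infinite word `σ` is the concatenation `w 0 ⌢ w 1 ⌢ ⋯`: all the finite concatenations are
prefixes of `σ`, and their lengths are unbounded (so that together they determine `σ`). -/
def IsInfiniteConcat {α : Type} (w : ℕ → List α) (σ : ℕ → α) : Prop :=
  (∀ n, concatFirst w n = (List.range (concatFirst w n).length).map σ) ∧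
    ∀ m, ∃ n, m ≤ (concatFirst w n).length

/-- The `ω`-power of `L`: the infinite words `w 0 ⌢ w 1 ⌢ ⋯` with `w i ∈ L` for all `i`. -/
def omegaPower {α : Type} (L : Language α) : Set (ℕ → α) :=
  {σ | ∃ w : ℕ → List α, (∀ i, w i ∈ L) ∧ IsInfiniteConcat w σ}

/-! Given a complete set P of the class in question, it suffices to find a language L with L^∞ in
that class and P reducible to L^∞. Unravelling the Borel definition of P exhibits it as the
projection of a closed K ⊆ 2^ω × ω^ω such that, when finitely many coordinates of the witness y are
prescribed, the projection still belongs to the class of P (`hasClosedWitness_sigma0_and_pi0`). A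
projection of an arbitrary closed set would only be analytic.

The language `codedLanguage K` simulates an automaton that reads x and guesses y. The point x is
written as blocks of zeros whose lengths name its finite prefixes. A word leads from a cut inside
one block to a cut inside a later block, and the place of the cut stores the state, a finite part of
y. The lengths are so sparse that the two halves of a cut block must agree on node and state
(`eq_of_cutLeft_add_cutRight`). Factorizations of a correctly coded sequence are therefore runs, and
since K is closed an infinite guessing run yields a witness (`exists_accepts_of_mem`,
`mem_of_startsWith`). Hence `encodeSeq` reduces P to L^∞.

Incorrectly coded sequences must not raise the complexity. Words containing an error, together with
the state `none`, which verifies nothing, put all of those with infinitely many ones into L^∞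
(`mem_of_not_properFrom`). So, inside the Π⁰_2 set of sequences with infinitely many ones, L^∞ is an
open set together with pieces, one for each initial state, that are governed by constrained
projections of K (`omegaPower_codedLanguage_eq`). This stays in Π⁰_ξ for ξ ≥ 2 and in Σ⁰_ξ for ξ ≥
3. The classes Π⁰_1, Σ⁰_1 and Σ⁰_2 get explicit languages. -/

/-! ### Closure properties of the Borel classes -/

theorem IsSigma0.preimage {X Z : Type} [TopologicalSpace X] [TopologicalSpace Z] {f : X → Z}
    (hf : Continuous f) {ξ : Ordinal.{0}} {s : Set Z} (hs : IsSigma0 ξ s) :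
    IsSigma0 ξ (f ⁻¹' s) := by
  induction hs with
  | of_isOpen s hs => exact .of_isOpen _ (hs.preimage hf)
  | iUnion ξ hξ γ s h1 hlt _ ih =>
    rw [Set.preimage_iUnion]
    exact .iUnion ξ hξ γ _ h1 hlt ih

theorem IsPi0.preimage {X Z : Type} [TopologicalSpace X] [TopologicalSpace Z] {f : X → Z}
    (hf : Continuous f) {ξ : Ordinal.{0}} {s : Set Z} (hs : IsPi0 ξ s) :
    IsPi0 ξ (f ⁻¹' s) :=
  IsSigma0.preimage hf (s := sᶜ) hs

/-- Decoding a branch is continuous only on a subspace of 2^ω; this transfers classes computed there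
back to 2^ω. -/
theorem IsSigma0.exists_subtype {X : Type} [TopologicalSpace X] {D : Set X} {ξ : Ordinal.{0}}
    {s : Set D} (hs : IsSigma0 ξ s) :
    ∃ t : Set X, IsSigma0 ξ t ∧ s = Subtype.val ⁻¹' t := by
  induction hs with
  | of_isOpen s hs =>
    obtain ⟨t, ht, rfl⟩ := isOpen_induced_iff.1 hs
    exact ⟨t, .of_isOpen _ ht, rfl⟩
  | iUnion ξ hξ γ s h1 hlt _ ih =>
    choose t ht hst using ih
    refine ⟨⋃ n, (t n)ᶜ, .iUnion ξ hξ γ _ h1 hlt fun n => by rw [compl_compl]; exact ht n, ?_⟩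
    rw [Set.preimage_iUnion]
    refine Set.iUnion_congr fun n => ?_
    rw [Set.preimage_compl, ← hst, compl_compl]

theorem IsPi0.exists_subtype {X : Type} [TopologicalSpace X] {D : Set X} {ξ : Ordinal.{0}}
    {s : Set D} (hs : IsPi0 ξ s) :
    ∃ t : Set X, IsPi0 ξ t ∧ s = Subtype.val ⁻¹' t := by
  obtain ⟨t, ht, h⟩ := IsSigma0.exists_subtype (s := sᶜ) hs
  refine ⟨tᶜ, by rwa [IsPi0, compl_compl], ?_⟩
  rw [Set.preimage_compl, ← h, compl_compl]

theorem isPi0_compl_iff {X : Type} [TopologicalSpace X] {ξ : Ordinal.{0}} {s : Set X} :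
    IsPi0 ξ sᶜ ↔ IsSigma0 ξ s := by
  rw [IsPi0, compl_compl]

theorem IsPi0.isSigma0_of_lt {X : Type} [TopologicalSpace X] {γ ξ : Ordinal.{0}} {s : Set X}
    (hs : IsPi0 γ s) (h1 : 1 ≤ γ) (hlt : γ < ξ) : IsSigma0 ξ s := by
  have h2 : 2 ≤ ξ := by
    have := Order.add_one_le_of_lt (h1.trans_lt hlt)
    rwa [one_add_one_eq_two] at this
  rw [isSigma0_iff h2]
  exact ⟨fun _ => γ, fun _ => s, fun _ => ⟨h1, hlt, hs⟩, (Set.iUnion_const s).symm⟩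

theorem IsSigma0.isPi0_of_lt {X : Type} [TopologicalSpace X] {γ ξ : Ordinal.{0}} {s : Set X}
    (hs : IsSigma0 γ s) (h1 : 1 ≤ γ) (hlt : γ < ξ) : IsPi0 ξ s :=
  IsPi0.isSigma0_of_lt (isPi0_compl_iff.2 hs) h1 hlt

theorem Ordinal.eq_one_or_two_le {ξ : Ordinal.{0}} (h1 : 1 ≤ ξ) : ξ = 1 ∨ 2 ≤ ξ := by
  rcases h1.eq_or_lt with h | h
  · exact .inl h.symm
  · right
    have := Order.add_one_le_of_lt h
    rwa [one_add_one_eq_two] at this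

theorem IsSigma0.one_le {X : Type} [TopologicalSpace X] {ξ : Ordinal.{0}} {s : Set X}
    (hs : IsSigma0 ξ s) : 1 ≤ ξ := by
  cases hs with
  | of_isOpen => exact le_rfl
  | iUnion _ h => exact le_trans (by exact_mod_cast one_le_two) h

theorem IsSigma0.iUnion_mem {X : Type} [TopologicalSpace X] {ξ : Ordinal.{0}} (h1 : 1 ≤ ξ)
    {s : ℕ → Set X} (hs : ∀ n, IsSigma0 ξ (s n)) : IsSigma0 ξ (⋃ n, s n) := by
  rcases Ordinal.eq_one_or_two_le h1 with rfl | h2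
  · simp only [isSigma0_one_iff] at hs ⊢
    exact isOpen_iUnion hs
  · simp only [isSigma0_iff h2] at hs
    choose γ t h ht using hs
    rw [isSigma0_iff h2]
    refine ⟨fun n => γ n.unpair.1 n.unpair.2, fun n => t n.unpair.1 n.unpair.2,
      fun n => h _ _, ?_⟩
    rw [Set.iUnion_congr ht, Set.iUnion_unpair t]

theorem IsSigma0.iUnion_countable {X : Type} [TopologicalSpace X] {ξ : Ordinal.{0}} (h1 : 1 ≤ ξ)
    {ι : Type} [Countable ι] [Nonempty ι] {s : ι → Set X} (hs : ∀ i, IsSigma0 ξ (s i)) :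
    IsSigma0 ξ (⋃ i, s i) := by
  obtain ⟨f, hf⟩ := exists_surjective_nat ι
  rw [← hf.iUnion_comp]
  exact .iUnion_mem h1 fun n => hs _

theorem IsPi0.iInter_countable {X : Type} [TopologicalSpace X] {ξ : Ordinal.{0}} (h1 : 1 ≤ ξ)
    {ι : Type} [Countable ι] [Nonempty ι] {s : ι → Set X} (hs : ∀ i, IsPi0 ξ (s i)) :
    IsPi0 ξ (⋂ i, s i) := by
  rw [IsPi0, Set.compl_iInter]
  exact .iUnion_countable h1 hs

theorem IsSigma0.union {X : Type} [TopologicalSpace X] {ξ : Ordinal.{0}} {s t : Set X}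
    (hs : IsSigma0 ξ s) (ht : IsSigma0 ξ t) : IsSigma0 ξ (s ∪ t) := by
  rw [Set.union_eq_iUnion]
  exact .iUnion_countable hs.one_le (by rintro (_ | _) <;> assumption)

theorem IsPi0.inter {X : Type} [TopologicalSpace X] {ξ : Ordinal.{0}} {s t : Set X}
    (hs : IsPi0 ξ s) (ht : IsPi0 ξ t) : IsPi0 ξ (s ∩ t) := by
  rw [IsPi0, Set.compl_inter]
  exact IsSigma0.union hs ht

/-! ### Cylinders, and monotonicity of the hierarchy on sequence spaces -/

section Sequences

variable {Y : Type} [TopologicalSpace Y] [DiscreteTopology Y]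

theorem continuous_of_agree {Z : Type} [TopologicalSpace Z] [DiscreteTopology Z]
    {f : (ℕ → Y) → ℕ → Z}
    (h : ∀ k, ∃ n, ∀ x x' : ℕ → Y, (∀ i < n, x i = x' i) → f x k = f x' k) : Continuous f := by
  refine continuous_pi fun k => ?_
  obtain ⟨n, hn⟩ := h k
  refine IsLocallyConstant.continuous ((IsLocallyConstant.iff_exists_open _).2 fun x => ?_)
  refine ⟨Set.pi (Set.Iio n) fun i => {x i}, ?_, by simp, fun x' hx' => ?_⟩
  · exact isOpen_set_pi (Set.finite_Iio n) fun _ _ => isOpen_discrete _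
  · exact hn _ _ fun i hi => hx' i hi

/-- The cylinder of the sequences that agree with `z` on the coordinates below `n`. -/
def agreeSet (z : ℕ → Y) (n : ℕ) : Set (ℕ → Y) := {x | ∀ i < n, x i = z i}

theorem agreeSet_congr {Y : Type} {x x' : ℕ → Y} {n : ℕ} (h : ∀ i < n, x i = x' i) :
    agreeSet x n = agreeSet x' n := by
  ext z
  exact forall₂_congr fun i hi => by rw [h i hi]

theorem exists_agreeSet_subset {Y : Type} [TopologicalSpace Y] {U : Set (ℕ → Y)}
    (hU : IsOpen U) {x : ℕ → Y} (hx : x ∈ U) :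
    ∃ n, agreeSet x n ⊆ U := by
  obtain ⟨I, u, hu, hI⟩ := isOpen_pi_iff.1 hU x hx
  refine ⟨I.sup id + 1, fun x' hx' => hI fun i hi => ?_⟩
  rw [hx' i (Nat.lt_succ_of_le (Finset.le_sup (f := id) hi))]
  exact (hu i hi).2

theorem IsOpen.exists_iUnion_isClopen [Countable Y] {U : Set (ℕ → Y)} (hU : IsOpen U) :
    ∃ C : ℕ → Set (ℕ → Y), (∀ n, IsClopen (C n)) ∧ U = ⋃ n, C n := by
  classical
  let cyl : List Y → Set (ℕ → Y) := fun l => {x | ∀ i < l.length, l[i]? = some (x i)}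
  have hcyl : ∀ l, IsClopen (cyl l) := fun l => by
    have : cyl l = ⋂ i ∈ Finset.range l.length, (fun x : ℕ → Y => x i) ⁻¹' {y | l[i]? = some y} := by
      ext x; simp [cyl]
    rw [this]
    exact isClopen_biInter_finset fun i _ => (isClopen_discrete _).preimage (continuous_apply i)
  obtain ⟨e, he⟩ := exists_surjective_nat (List Y)
  refine ⟨fun n => if cyl (e n) ⊆ U then cyl (e n) else ∅, fun n => ?_, ?_⟩
  · dsimp only
    split_ifs
    exacts [hcyl _, isClopen_empty]
  · ext x
    rw [Set.mem_iUnion]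
    constructor
    · intro hx
      obtain ⟨n, hn⟩ := exists_agreeSet_subset hU hx
      obtain ⟨m, hm⟩ := he ((List.range n).map x)
      have hsub : cyl (e m) ⊆ U := by
        intro x' hx'
        apply hn
        intro i hi
        have := hx' i (by simpa [hm] using hi)
        simp [hm, hi] at this
        exact this.symm
      refine ⟨m, ?_⟩
      rw [if_pos hsub]
      intro i hi
      have hi' : i < n := by simpa [hm] using hi
      simp [hm, hi']
    · rintro ⟨n, hn⟩
      split_ifs at hn with h
      exacts [h hn, hn.elim]

/-- Only level 1 depends on the space: open sets are countable unions of clopen sets. Above it, the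
same union serves. -/
theorem IsSigma0.mono [Countable Y] {γ ξ : Ordinal.{0}} {s : Set (ℕ → Y)}
    (hs : IsSigma0 γ s) (hle : γ ≤ ξ) : IsSigma0 ξ s := by
  rcases hle.eq_or_lt with rfl | hlt
  · exact hs
  have h1 := hs.one_le
  rcases Ordinal.eq_one_or_two_le h1 with rfl | h2
  · obtain ⟨C, hC, rfl⟩ := ((isSigma0_one_iff s).1 hs).exists_iUnion_isClopen
    rw [isSigma0_iff ((Ordinal.eq_one_or_two_le hle).resolve_left hlt.ne')]
    exact ⟨fun _ => 1, C, fun n => ⟨le_rfl, hlt, (isPi0_one_iff _).2 (hC n).1⟩, rfl⟩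
  · rw [isSigma0_iff (h2.trans hle)]
    obtain ⟨δ, t, h, rfl⟩ := (isSigma0_iff h2 _).1 hs
    exact ⟨δ, t, fun n => ⟨(h n).1, (h n).2.1.trans hlt, (h n).2.2⟩, rfl⟩

theorem IsPi0.mono [Countable Y] {γ ξ : Ordinal.{0}} {s : Set (ℕ → Y)}
    (hs : IsPi0 γ s) (hle : γ ≤ ξ) : IsPi0 ξ s :=
  IsSigma0.mono (s := sᶜ) hs hle

theorem IsOpen.isSigma0 [Countable Y] {ξ : Ordinal.{0}} (h1 : 1 ≤ ξ) {s : Set (ℕ → Y)}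
    (hs : IsOpen s) : IsSigma0 ξ s :=
  ((isSigma0_one_iff s).2 hs).mono h1

theorem IsClosed.isPi0 [Countable Y] {ξ : Ordinal.{0}} (h1 : 1 ≤ ξ) {s : Set (ℕ → Y)}
    (hs : IsClosed s) : IsPi0 ξ s :=
  ((isPi0_one_iff s).2 hs).mono h1

theorem IsSigma0.inter [Countable Y] {ξ : Ordinal.{0}} {s t : Set (ℕ → Y)}
    (hs : IsSigma0 ξ s) (ht : IsSigma0 ξ t) : IsSigma0 ξ (s ∩ t) := by
  rcases Ordinal.eq_one_or_two_le hs.one_le with rfl | h2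
  · rw [isSigma0_one_iff] at *
    exact IsOpen.inter hs ht
  · obtain ⟨γ, u, hu, rfl⟩ := (isSigma0_iff h2 _).1 hs
    obtain ⟨δ, v, hv, rfl⟩ := (isSigma0_iff h2 _).1 ht
    rw [Set.iUnion_inter_iUnion]
    refine .iUnion_mem hs.one_le fun i => .iUnion_mem hs.one_le fun j => ?_
    refine IsPi0.isSigma0_of_lt (γ := max (γ i) (δ j)) ?_ (le_max_of_le_left (hu _).1)
      (max_lt (hu _).2.1 (hv _).2.1)
    exact ((hu _).2.2.mono (le_max_left _ _)).inter ((hv _).2.2.mono (le_max_right _ _))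

theorem IsPi0.union [Countable Y] {ξ : Ordinal.{0}} {s t : Set (ℕ → Y)}
    (hs : IsPi0 ξ s) (ht : IsPi0 ξ t) : IsPi0 ξ (s ∪ t) := by
  rw [IsPi0, Set.compl_union]
  exact IsSigma0.inter hs ht

end Sequences

/-! ### Borel sets as projections of closed sets with controlled sections -/

/-- The set of the `x` such that some pair `(x, y) ∈ K` satisfies `y i = z i` for all `i ∈ I`. -/
def constrainedProj {X : Type} (K : Set (X × (ℕ → ℕ))) (I : Finset ℕ) (z : ℕ → ℕ) : Set X :=
  {x | ∃ y, (∀ i ∈ I, y i = z i) ∧ (x, y) ∈ K}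

/-- `P` is the projection of a closed set all of whose sections over cylinders of `ℕ → ℕ` have
a projection in the class `Γ`. -/
def HasClosedWitness {X : Type} [TopologicalSpace X] (Γ : Set X → Prop) (P : Set X) : Prop :=
  ∃ K : Set (X × (ℕ → ℕ)), IsClosed K ∧ (∀ I z, Γ (constrainedProj K I z)) ∧
    ∀ x, x ∈ P ↔ ∃ y, (x, y) ∈ K

section Witness

variable {Y : Type} [TopologicalSpace Y] [DiscreteTopology Y] [Countable Y]

/-- Coordinate 0 of the witness names an index n and the rest is a witness for `s n`. A constraint
on coordinate 0 selects one n; without it, the projection is a union over all n. -/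
theorem hasClosedWitness_iUnion {X : Type} [TopologicalSpace X] {ξ : Ordinal.{0}}
    (h1 : 1 ≤ ξ) {Γ : ℕ → Set X → Prop} {s : ℕ → Set X} (hΓ : ∀ n t, Γ n t → IsSigma0 ξ t)
    (hs : ∀ n, HasClosedWitness (Γ n) (s n)) :
    HasClosedWitness (IsSigma0 ξ) (⋃ n, s n) := by
  choose K hK hproj hsK using hs
  refine ⟨{p | (p.1, fun i => p.2 (i + 1)) ∈ K (p.2 0)}, ?_, fun I z => ?_, fun x => ?_⟩
  · rw [← isOpen_compl_iff, isOpen_iff_mem_nhds]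
    rintro ⟨x, y⟩ hxy
    have hc : Continuous fun p : X × (ℕ → ℕ) => (p.1, fun i => p.2 (i + 1)) := by fun_prop
    have hc0 : Continuous fun p : X × (ℕ → ℕ) => p.2 0 := by fun_prop
    have e1 := ((hK (y 0)).isOpen_compl.preimage hc).mem_nhds (x := (x, y)) hxy
    have e2 := ((isOpen_discrete {y 0}).preimage hc0).mem_nhds (x := (x, y)) rfl
    filter_upwards [e1, e2] with p hp1 hp2
    simp only [Set.mem_preimage, Set.mem_singleton_iff] at hp2
    simpa [hp2] using hp1
  · let J : Finset ℕ := I.preimage (· + 1) (add_left_injective 1).injOn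
    have key : ∀ n x, x ∈ constrainedProj (K n) J (fun i => z (i + 1)) ↔
        ∃ y : ℕ → ℕ, (y 0 = n) ∧ (∀ i, i + 1 ∈ I → y (i + 1) = z (i + 1)) ∧
          (x, fun i => y (i + 1)) ∈ K (y 0) := by
      intro n x
      constructor
      · rintro ⟨y, hy, hx⟩
        refine ⟨fun i => Nat.casesOn i n y, rfl, fun i hi => hy i (by simpa [J] using hi), hx⟩
      · rintro ⟨y, rfl, hy, hx⟩
        exact ⟨_, fun i hi => hy i (by simpa [J] using hi), hx⟩
    by_cases h0 : 0 ∈ I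
    · convert hΓ (z 0) _ (hproj (z 0) J fun i => z (i + 1)) using 1
      ext x
      rw [key]
      constructor
      · rintro ⟨y, hy, hx⟩
        exact ⟨y, hy 0 h0, fun i hi => hy _ hi, hx⟩
      · rintro ⟨y, h0', hy, hx⟩
        refine ⟨y, fun i hi => ?_, hx⟩
        cases i with
        | zero => exact h0'
        | succ i => exact hy i hi
    · have : constrainedProj {p : X × (ℕ → ℕ) | (p.1, fun i => p.2 (i + 1)) ∈ K (p.2 0)} I z =
          ⋃ n, constrainedProj (K n) J fun i => z (i + 1) := by
        ext x
        simp only [Set.mem_iUnion, key]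
        constructor
        · rintro ⟨y, hy, hx⟩
          exact ⟨_, y, rfl, fun i hi => hy _ hi, hx⟩
        · rintro ⟨_, y, -, hy, hx⟩
          refine ⟨y, fun i hi => ?_, hx⟩
          cases i with
          | zero => exact absurd hi h0
          | succ i => exact hy i hi
      rw [this]
      exact .iUnion_mem h1 fun n => hΓ n _ (hproj n _ _)
  · simp only [Set.mem_iUnion, hsK]
    constructor
    · rintro ⟨n, y, hy⟩
      refine ⟨fun i => Nat.casesOn i n y, ?_⟩
      exact hy
    · rintro ⟨y, hy⟩
      exact ⟨_, _, hy⟩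

/-- Witnesses for all `s n` are interleaved by `Nat.pair`. Distinct n use disjoint coordinates, so
constrained projections commute with the intersection. -/
theorem hasClosedWitness_iInter {X : Type} [TopologicalSpace X] {Γ : Set X → Prop}
    {Δ : ℕ → Set X → Prop} {s : ℕ → Set X}
    (hΓ : ∀ t : ℕ → Set X, (∀ n, Δ n (t n)) → Γ (⋂ n, t n))
    (hs : ∀ n, HasClosedWitness (Δ n) (s n)) : HasClosedWitness Γ (⋂ n, s n) := by
  choose K hK hproj hsK using hs
  refine ⟨{p | ∀ n, (p.1, fun i => p.2 (Nat.pair n i)) ∈ K n}, ?_, fun I z => ?_, fun x => ?_⟩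
  · rw [Set.ofPred_forall]
    refine isClosed_iInter fun n => (hK n).preimage (f := fun p : X × (ℕ → ℕ) =>
      (p.1, fun i => p.2 (Nat.pair n i))) (by fun_prop)
  · have hinj : ∀ n, Function.Injective (Nat.pair n) := fun n a b h => (Nat.pair_eq_pair.1 h).2
    let J : ℕ → Finset ℕ := fun n => I.preimage (Nat.pair n) (hinj n).injOn
    convert hΓ _ fun n => hproj n (J n) fun i => z (Nat.pair n i)
    ext x
    rw [Set.mem_iInter]
    constructor
    · rintro ⟨y, hy, hx⟩ n
      exact ⟨_, fun i hi => hy _ (by simpa [J] using hi), hx n⟩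
    · intro h
      choose y hy hx using h
      refine ⟨fun i => y i.unpair.1 i.unpair.2, fun i hi => ?_, fun n => ?_⟩
      · have := hy i.unpair.1 i.unpair.2 (by simpa [J] using hi)
        simpa using this
      · simpa using hx n
  · simp only [Set.mem_iInter, hsK]
    constructor
    · intro h
      choose y hy using h
      exact ⟨fun i => y i.unpair.1 i.unpair.2, fun n => by simpa using hy n⟩
    · rintro ⟨y, hy⟩ n
      exact ⟨_, hy n⟩

theorem hasClosedWitness_of_isClosed {X : Type} [TopologicalSpace X] {Γ : Set X → Prop}
    {P : Set X} (hP : IsClosed P) (hΓ : Γ P) : HasClosedWitness Γ P := by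
  refine ⟨Prod.fst ⁻¹' P, hP.preimage continuous_fst, fun I z => ?_, fun x => ?_⟩
  · convert hΓ
    ext x
    exact ⟨fun ⟨y, _, h⟩ => h, fun h => ⟨z, fun _ _ => rfl, h⟩⟩
  · exact ⟨fun h => ⟨0, h⟩, fun ⟨_, h⟩ => h⟩

theorem hasClosedWitness_sigma0_and_pi0 (ξ : Ordinal.{0}) (s : Set (ℕ → Y)) :
    (IsSigma0 ξ s → HasClosedWitness (IsSigma0 ξ) s) ∧
      (IsPi0 ξ s → HasClosedWitness (IsPi0 ξ) s) := by
  induction ξ using WellFoundedLT.induction generalizing s with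
  | ind ξ ih =>
    constructor
    · intro hs
      rcases Ordinal.eq_one_or_two_le hs.one_le with rfl | h2
      · obtain ⟨C, hC, rfl⟩ := ((isSigma0_one_iff s).1 hs).exists_iUnion_isClopen
        exact hasClosedWitness_iUnion (Γ := fun _ => IsSigma0 1) le_rfl (fun _ _ => id)
          fun n => hasClosedWitness_of_isClosed (hC n).1 ((isSigma0_one_iff _).2 (hC n).2)
      · obtain ⟨γ, t, ht, rfl⟩ := (isSigma0_iff h2 _).1 hs
        exact hasClosedWitness_iUnion (Γ := fun n => IsPi0 (γ n)) hs.one_le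
          (fun n u hu => hu.isSigma0_of_lt (ht n).1 (ht n).2.1)
          fun n => (ih _ (ht n).2.1 _).2 (ht n).2.2
    · intro hs
      rcases Ordinal.eq_one_or_two_le (IsSigma0.one_le hs) with rfl | h2
      · exact hasClosedWitness_of_isClosed ((isPi0_one_iff s).1 hs) hs
      · obtain ⟨γ, t, ht, rfl⟩ := (isPi0_iff h2 _).1 hs
        exact hasClosedWitness_iInter (Δ := fun n => IsSigma0 (γ n))
          (fun u hu => (isPi0_iff h2 _).2 ⟨γ, u, fun n => ⟨(ht n).1, (ht n).2.1, hu n⟩, rfl⟩)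
          fun n => (ih _ (ht n).2.1 _).1 (ht n).2.2

end Witness

/-! ### Complete sets in each class -/

section Complete

theorem IsCompleteFor.of_reducible {Γ : ∀ (X : Type) [TopologicalSpace X], Set X → Prop}
    {Z Z' : Type} [TopologicalSpace Z] [TopologicalSpace Z'] {C : Set Z} {C' : Set Z'}
    (hC : IsCompleteFor Γ C) (hC' : Γ Z' C') (h : IsWadgeReducible C C') :
    IsCompleteFor Γ C' := by
  refine ⟨hC', fun Y _ _ _ A hA => ?_⟩
  obtain ⟨f, hf, rfl⟩ := hC.2 Y A hA
  obtain ⟨g, hg, rfl⟩ := h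
  exact ⟨g ∘ f, hg.comp hf, rfl⟩

/-- The reduction writes a 1 at exactly those stages where the current cylinder of x misses A. -/
theorem isCompleteFor_pi0_one : IsCompleteFor (fun X _ => IsPi0 (X := X) 1)
    ({0} : Set (ℕ → Fin 2)) := by
  classical
  refine ⟨(isPi0_one_iff _).2 isClosed_singleton, fun Y _ _ _ A hA => ?_⟩
  have hA' : IsClosed A := (isPi0_one_iff A).1 hA
  refine ⟨fun x n => if (agreeSet x n ∩ A).Nonempty then 0 else 1,
    continuous_of_agree fun k => ⟨k, fun x x' h => ?_⟩, ?_⟩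
  · rw [agreeSet_congr h]
  · ext x
    rw [Set.mem_preimage, Set.mem_singleton_iff, funext_iff]
    constructor
    · intro hx n
      exact if_pos ⟨x, fun _ _ => rfl, hx⟩
    · intro h
      by_contra hx
      obtain ⟨n, hn⟩ := exists_agreeSet_subset hA'.isOpen_compl hx
      have := h n
      simp only [Pi.zero_apply, ite_eq_left_iff, one_ne_zero, imp_false, not_not] at this
      obtain ⟨z, hz, hzA⟩ := this
      exact hn hz hzA

theorem IsCompleteFor.compl_pi0 {ξ : Ordinal.{0}} {Z : Type} [TopologicalSpace Z] {C : Set Z}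
    (hC : IsCompleteFor (fun X _ => IsPi0 (X := X) ξ) C) :
    IsCompleteFor (fun X _ => IsSigma0 (X := X) ξ) Cᶜ := by
  refine ⟨hC.1, fun Y _ _ _ A hA => ?_⟩
  obtain ⟨f, hf, h⟩ := hC.2 Y Aᶜ (isPi0_compl_iff.2 hA)
  exact ⟨f, hf, by rw [Set.preimage_compl, ← h, compl_compl]⟩

/-- A Π⁰_ξ set is an intersection of sets `s b` whose levels are not known in advance. Hence row ⟨a,
b⟩ tests `s b` only if its level is `enum a`; otherwise the row is filled with a point that makes
its condition vacuous. -/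
theorem exists_isCompleteFor_pi0 (ξ : Ordinal.{0}) (h1 : 1 ≤ ξ)
    (hξ : ξ.card ≤ Cardinal.aleph0) :
    ∃ C : Set (ℕ → Fin 2), IsCompleteFor (fun X _ => IsPi0 (X := X) ξ) C := by
  classical
  induction ξ using WellFoundedLT.induction with
  | ind ξ ih =>
  rcases Ordinal.eq_one_or_two_le h1 with rfl | h2
  · exact ⟨_, isCompleteFor_pi0_one⟩
  have hlt1 : (1 : Ordinal) < ξ := lt_of_lt_of_le (by exact_mod_cast one_lt_two) h2
  have hcount : Countable (Set.Ico 1 ξ) := by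
    have : (Set.Iio ξ).Countable := by
      rw [← Cardinal.le_aleph0_iff_set_countable, Cardinal.mk_Iio_ordinal]
      rw [Cardinal.lift_le_aleph0]
      exact hξ
    exact (this.mono fun x hx => hx.2).to_subtype
  have : Nonempty (Set.Ico 1 ξ) := ⟨⟨1, le_rfl, hlt1⟩⟩
  obtain ⟨enum, henum⟩ := exists_surjective_nat (Set.Ico 1 ξ)
  have hC : ∀ γ : Set.Ico 1 ξ, ∃ C : Set (ℕ → Fin 2),
      IsCompleteFor (fun X _ => IsPi0 (X := X) γ.1) C := fun γ =>
    ih γ.1 γ.2.2 γ.2.1 ((Ordinal.card_le_card γ.2.2.le).trans hξ)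
  choose C hC using hC
  have hne : ∀ γ : Set.Ico 1 ξ, ∃ z, z ∉ C γ := by
    intro γ
    -- The empty set is reducible to `C γ`, and every value of the reduction lies outside `C γ`.
    obtain ⟨f, -, hf⟩ := (hC γ).2 (Fin 2) ∅ (isClosed_empty.isPi0 γ.2.1)
    exact ⟨f 0, fun h => by simpa using hf.symm.subset h⟩
  choose z hz using hne
  let row : ℕ → (ℕ → Fin 2) → ℕ → Fin 2 := fun n x k => x (Nat.pair n k)
  have hrow : ∀ n, Continuous (row n) := fun n => by fun_prop
  let g : ℕ → Set.Ico 1 ξ := fun n => enum n.unpair.1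
  refine ⟨⋂ n, row n ⁻¹' (C (g n))ᶜ, ?_, fun Y _ _ _ A hA => ?_⟩
  · refine (isPi0_iff h2 _).2 ?_
    exact ⟨fun n => g n, _, fun n => ⟨(g n).2.1, (g n).2.2,
      IsSigma0.preimage (hrow n) (hC (g n)).1⟩, rfl⟩
  · obtain ⟨δ, s, hs, rfl⟩ := (isPi0_iff h2 _).1 hA
    have hred : ∀ n, ∃ f : (ℕ → Y) → ℕ → Fin 2, Continuous f ∧
        ((g n).1 = δ n.unpair.2 → (s n.unpair.2)ᶜ = f ⁻¹' C (g n)) ∧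
        ((g n).1 ≠ δ n.unpair.2 → ∀ x, f x ∉ C (g n)) := by
      intro n
      by_cases h : (g n).1 = δ n.unpair.2
      · obtain ⟨f, hf, hf'⟩ := (hC (g n)).2 Y (s n.unpair.2)ᶜ
          (isPi0_compl_iff.2 (h ▸ (hs n.unpair.2).2.2))
        exact ⟨f, hf, fun _ => hf', fun h' => absurd h h'⟩
      · exact ⟨fun _ => z (g n), continuous_const, fun h' => absurd h' h, fun _ _ => hz _⟩
    choose f hf hfs hfz using hred
    refine ⟨fun x k => f k.unpair.1 x k.unpair.2, ?_, ?_⟩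
    · exact continuous_pi fun k => (continuous_apply _).comp (hf _)
    · ext x
      have hrx : ∀ n, row n (fun k => f k.unpair.1 x k.unpair.2) = f n x := fun n => by
        funext k; simp [row]
      simp only [Set.mem_iInter, Set.mem_preimage, Set.mem_compl_iff, hrx]
      constructor
      · intro h n hn
        by_cases hg : (g n).1 = δ n.unpair.2
        · have : x ∈ (s n.unpair.2)ᶜ := by rw [hfs n hg]; exact hn
          exact this (h _)
        · exact hfz n hg x hn
      · intro h n
        obtain ⟨a, ha⟩ := henum ⟨δ n, (hs n).1, (hs n).2.1⟩
        have hg : (g (Nat.pair a n)).1 = δ (Nat.pair a n).unpair.2 := by simp [g, ha]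
        by_contra hx
        have : x ∈ f (Nat.pair a n) ⁻¹' C (g (Nat.pair a n)) := by
          rw [← hfs _ hg]; simpa using hx
        exact h _ this

end Complete

/-! ### Occurrences of words and factorizations -/

section Words

variable {α : Type}

/-- The word `l` occurs in the infinite word `σ` at position `p`. -/
def OccursAt (σ : ℕ → α) (p : ℕ) (l : List α) : Prop :=
  (List.range l.length).map (fun i => σ (p + i)) = l

theorem occursAt_iff_getElem {σ : ℕ → α} {p : ℕ} {l : List α} :
    OccursAt σ p l ↔ ∀ (i : ℕ) (h : i < l.length), σ (p + i) = l[i] := by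
  unfold OccursAt
  rw [List.ext_getElem_iff]
  simp

theorem occursAt_nil (σ : ℕ → α) (p : ℕ) : OccursAt σ p [] := rfl

theorem occursAt_append {σ : ℕ → α} {p : ℕ} {l l' : List α} :
    OccursAt σ p (l ++ l') ↔ OccursAt σ p l ∧ OccursAt σ (p + l.length) l' := by
  unfold OccursAt
  simp only [List.length_append, List.range_add, List.map_append, List.map_map,
    Function.comp_def, add_assoc]
  exact ⟨fun h => List.append_inj h (by simp), fun h => by rw [h.1, h.2]⟩

theorem occursAt_cons {σ : ℕ → α} {p : ℕ} {a : α} {l : List α} :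
    OccursAt σ p (a :: l) ↔ σ p = a ∧ OccursAt σ (p + 1) l := by
  rw [← List.singleton_append, occursAt_append]
  simp [OccursAt]

theorem occursAt_singleton {σ : ℕ → α} {p : ℕ} {a : α} : OccursAt σ p [a] ↔ σ p = a := by
  simp [OccursAt]

theorem occursAt_replicate {σ : ℕ → α} {p m : ℕ} {a : α} :
    OccursAt σ p (List.replicate m a) ↔ ∀ i < m, σ (p + i) = a := by
  simp [occursAt_iff_getElem]

theorem OccursAt.prefix {σ : ℕ → α} {p : ℕ} {l l' : List α} (h : OccursAt σ p l')
    (hl : l <+: l') : OccursAt σ p l := by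
  obtain ⟨t, rfl⟩ := hl
  exact (occursAt_append.1 h).1

theorem OccursAt.isPrefix {σ : ℕ → α} {p : ℕ} {l l' : List α} (h : OccursAt σ p l)
    (h' : OccursAt σ p l') (hlen : l.length ≤ l'.length) : l <+: l' := by
  rw [← h, ← h']
  refine List.IsPrefix.map _ ?_
  obtain ⟨k, hk⟩ := Nat.exists_eq_add_of_le hlen
  rw [hk, List.range_add]
  exact List.prefix_append _ _

/-- The factor of `σ` of length `n` at position `p`. -/
def factor (σ : ℕ → α) (p n : ℕ) : List α := (List.range n).map fun i => σ (p + i)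

@[simp] theorem length_factor (σ : ℕ → α) (p n : ℕ) : (factor σ p n).length = n := by
  simp [factor]

theorem occursAt_factor (σ : ℕ → α) (p n : ℕ) : OccursAt σ p (factor σ p n) := by
  simp [OccursAt, factor]

theorem OccursAt.eq_factor {σ : ℕ → α} {p : ℕ} {l : List α} (h : OccursAt σ p l) :
    l = factor σ p l.length := h.symm

theorem factor_add (σ : ℕ → α) (p m n : ℕ) :
    factor σ p (m + n) = factor σ p m ++ factor σ (p + m) n := by
  simp [factor, List.range_add, Function.comp_def, add_assoc]

theorem factor_congr {σ τ : ℕ → α} {n : ℕ} (h : ∀ i < n, σ i = τ i) :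
    factor σ 0 n = factor τ 0 n := by
  simpa [factor] using h

theorem OccursAt.isPrefix_factor {σ : ℕ → α} {p n : ℕ} {l : List α} (h : OccursAt σ p l)
    (hn : l.length ≤ n) : l <+: factor σ p n :=
  h.isPrefix (occursAt_factor σ p n) (by simpa using hn)

theorem OccursAt.isSuffix_factor {σ : ℕ → α} {p p' n : ℕ} {l : List α} (h : OccursAt σ p' l)
    (hp : p ≤ p') (hn : p + n = p' + l.length) : l <:+ factor σ p n := by
  obtain ⟨k, rfl⟩ := Nat.exists_eq_add_of_le hp
  obtain rfl : n = k + l.length := by omega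
  rw [factor_add, ← h.eq_factor]
  exact List.suffix_append _ _

theorem OccursAt.isInfix_factor {σ : ℕ → α} {p p' n : ℕ} {l : List α} (h : OccursAt σ p' l)
    (hp : p ≤ p') (hn : p' + l.length ≤ p + n) : l <:+: factor σ p n := by
  obtain ⟨k, rfl⟩ := Nat.exists_eq_add_of_le hp
  obtain ⟨m, rfl⟩ : ∃ m, n = k + l.length + m := ⟨n - k - l.length, by omega⟩
  rw [factor_add, factor_add, ← h.eq_factor]
  exact ⟨_, _, rfl⟩

theorem OccursAt.exists_of_isSuffix {σ : ℕ → α} {p : ℕ} {l l' : List α} (h : OccursAt σ p l')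
    (hl : l <:+ l') : ∃ p', p ≤ p' ∧ p' + l.length = p + l'.length ∧ OccursAt σ p' l := by
  obtain ⟨t, rfl⟩ := hl
  refine ⟨p + t.length, by omega, ?_, (occursAt_append.1 h).2⟩
  rw [List.length_append]
  omega

theorem OccursAt.exists_of_isInfix {σ : ℕ → α} {p : ℕ} {l l' : List α} (h : OccursAt σ p l')
    (hl : l <:+: l') : ∃ p', p ≤ p' ∧ p' + l.length ≤ p + l'.length ∧ OccursAt σ p' l := by
  obtain ⟨t, u, rfl⟩ := hl
  refine ⟨p + t.length, by omega, ?_, (occursAt_append.1 (occursAt_append.1 h).1).2⟩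
  simp only [List.length_append]
  omega

theorem exists_limit_of_chain {ι : Type} (l : ι → List α)
    (hcomp : ∀ i j, (l i).length ≤ (l j).length → l i <+: l j)
    (hunb : ∀ N, ∃ i, N ≤ (l i).length) : ∃ y : ℕ → α, ∀ i, OccursAt y 0 (l i) := by
  choose f hf using fun k => hunb (k + 1)
  refine ⟨fun k => (l (f k))[k]'(hf k), fun i => occursAt_iff_getElem.2 fun k hk => ?_⟩
  simp only [zero_add]
  rcases le_total (l i).length (l (f k)).length with h | h
  · exact ((hcomp _ _ h).getElem hk).symm
  · exact (hcomp _ _ h).getElem (hf k)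

theorem isClopen_occursAt [TopologicalSpace α] [DiscreteTopology α] (p : ℕ) (l : List α) :
    IsClopen {σ : ℕ → α | OccursAt σ p l} := by
  have : {σ : ℕ → α | OccursAt σ p l} =
      ⋂ i : Fin l.length, (fun σ : ℕ → α => σ (p + i)) ⁻¹' {l[i]} := by
    ext σ
    simp only [Set.mem_ofPred_eq, occursAt_iff_getElem, Set.mem_iInter]
    exact ⟨fun h i => h i i.2, fun h i hi => h ⟨i, hi⟩⟩
  rw [this]
  exact isClopen_iInter_of_finite fun i =>
    (isClopen_discrete _).preimage (continuous_apply (p + (i : ℕ)))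

theorem concatFirst_succ (w : ℕ → List α) (n : ℕ) :
    concatFirst w (n + 1) = concatFirst w n ++ w n := by
  simp [concatFirst, List.range_succ]

/-- Since words are nonempty, the cut positions are automatically unbounded. -/
theorem mem_omegaPower_iff {L : Language α} (hL : [] ∉ L) {σ : ℕ → α} :
    σ ∈ omegaPower L ↔ ∃ (w : ℕ → List α) (n : ℕ → ℕ), n 0 = 0 ∧
      ∀ i, w i ∈ L ∧ OccursAt σ (n i) (w i) ∧ n (i + 1) = n i + (w i).length := by
  constructor
  · rintro ⟨w, hw, hσ, -⟩
    refine ⟨w, fun i => (concatFirst w i).length, rfl, fun i => ⟨hw i, ?_, ?_⟩⟩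
    · have h := hσ (i + 1)
      have h' : OccursAt σ 0 (concatFirst w (i + 1)) := by
        unfold OccursAt
        simpa using h.symm
      rw [concatFirst_succ, occursAt_append] at h'
      simpa using h'.2
    · simp [concatFirst_succ]
  · rintro ⟨w, n, h0, h⟩
    have hlen : ∀ i, (concatFirst w i).length = n i := by
      intro i
      induction i with
      | zero => simp [concatFirst, h0]
      | succ i ih => rw [concatFirst_succ, List.length_append, ih, (h i).2.2]
    refine ⟨w, fun i => (h i).1, fun i => ?_, fun m => ⟨m, ?_⟩⟩
    · have : OccursAt σ 0 (concatFirst w i) := by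
        induction i with
        | zero => exact occursAt_nil _ _
        | succ i ih =>
          rw [concatFirst_succ, occursAt_append, hlen, zero_add]
          exact ⟨ih, (h i).2.1⟩
      have h' := this.symm
      simpa using h'
    · rw [hlen]
      induction m with
      | zero => omega
      | succ m ih =>
        have : w m ≠ [] := fun hm => hL (hm ▸ (h m).1)
        have := List.length_pos_iff.2 this
        have := (h m).2.2
        omega

/-- `G` is an invariant of cut positions, from which a factorization is built word by word. -/
theorem mem_omegaPower_of_step {L : Language α} (hL : [] ∉ L) {σ : ℕ → α} (G : ℕ → Prop)
    (h0 : G 0) (hG : ∀ p, G p → ∃ n, factor σ p n ∈ L ∧ G (p + n)) : σ ∈ omegaPower L := by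
  choose f hf using hG
  let pos : ℕ → {p // G p} := fun i =>
    i.rec ⟨0, h0⟩ fun _ p => ⟨p.1 + f p.1 p.2, (hf p.1 p.2).2⟩
  refine (mem_omegaPower_iff hL).2 ⟨fun i => factor σ (pos i).1 (f (pos i).1 (pos i).2),
    fun i => (pos i).1, rfl, fun i => ⟨(hf _ _).1, occursAt_factor _ _ _, ?_⟩⟩
  rw [length_factor]

end Words

/-! ### Block lengths, cuts and the coded language -/

open Encodable

/-- The number of zeros of the block that codes the node `e`. -/
def blockLen (e : List (Fin 2)) : ℕ := 3 * 4 ^ (encode e + 1)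

/-- The number of zeros of the block of `e` before its cut for the state `o`. -/
def cutLeft (e : List (Fin 2)) (o : Option (List ℕ)) : ℕ := 4 ^ (encode e + 1) + encode o

/-- The number of zeros of the block of `e` after its cut for the state `o`. -/
def cutRight (e : List (Fin 2)) (o : Option (List ℕ)) : ℕ := 2 * 4 ^ (encode e + 1) - encode o

/-- The state `o` is small enough to have a cut in the block of `e`. -/
def Admissible (e : List (Fin 2)) (o : Option (List ℕ)) : Prop := encode o ≤ encode e + 1

theorem Admissible.lt {e : List (Fin 2)} {o : Option (List ℕ)} (h : Admissible e o) :
    encode o < 4 ^ (encode e + 1) :=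
  lt_of_le_of_lt h (Nat.lt_pow_self (by norm_num))

theorem admissible_none (e : List (Fin 2)) : Admissible e none := by
  simp [Admissible]

theorem cutLeft_add_cutRight {e : List (Fin 2)} {o : Option (List ℕ)} (h : Admissible e o) :
    cutLeft e o + cutRight e o = blockLen e := by
  have := h.lt
  unfold cutLeft cutRight blockLen
  omega

theorem blockLen_injective : Function.Injective blockLen := by
  intro e e' h
  have h' : 4 ^ (encode e + 1) = 4 ^ (encode e' + 1) := by
    unfold blockLen at h
    omega
  have := Nat.pow_right_injective (by norm_num : 2 ≤ 4) h'
  exact encode_injective (by simpa using this)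

/-- Write A, B, C for the powers of 4 attached to `e`, `e'`, `r`. The left part lies in [A, 2A), the
right part in (B, 2B], and the sum is 3C. A power above C is at least 4C, which is too large; a
power below C is at most C/4, which leaves the sum too small. So A = B = C, and the offsets must
cancel. -/
theorem eq_of_cutLeft_add_cutRight {e e' r : List (Fin 2)} {o o' : Option (List ℕ)}
    (h : Admissible e o) (h' : Admissible e' o') (hr : cutLeft e o + cutRight e' o' = blockLen r) :
    e = r ∧ e' = r ∧ o = o' := by
  have mono : ∀ {a b : ℕ}, a < b → 4 * 4 ^ (a + 1) ≤ 4 ^ (b + 1) := fun {a b} hab => by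
    rw [← pow_succ']
    exact Nat.pow_le_pow_right (by norm_num) (by omega)
  have hl := h.lt
  have hl' := h'.lt
  unfold cutLeft cutRight blockLen at hr
  have key : encode e = encode r ∧ encode e' = encode r := by
    rcases lt_trichotomy (encode e) (encode r) with a | a | a <;>
    rcases lt_trichotomy (encode e') (encode r) with b | b | b <;>
    rcases lt_trichotomy (encode e) (encode e') with c | c | c <;>
    (first | exact ⟨a, b⟩ | skip) <;>
    (try have a' := mono a) <;> (try have b' := mono b) <;> (try have c' := mono c) <;>
    (try rw [a] at hr hl c') <;> (try rw [b] at hr hl' c') <;>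
    omega
  have e1 := encode_injective key.1
  have e2 := encode_injective key.2
  subst e1
  subst e2
  exact ⟨rfl, rfl, encode_injective (by omega)⟩

/-- The word `1 0^m 1`. -/
def block (m : ℕ) : List (Fin 2) := 1 :: (List.replicate m 0 ++ [1])

/-- The word `1 0^m 1 0^m' 1`. -/
def doubleBlock (m m' : ℕ) : List (Fin 2) :=
  1 :: (List.replicate m 0 ++ 1 :: (List.replicate m' 0 ++ [1]))

/-- `m` and `m'` are the lengths of the blocks of a node and of one of its children. -/
def IsChildLen (m m' : ℕ) : Prop := ∃ e b, m = blockLen e ∧ m' = blockLen (e ++ [b])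

/-- Some pair in `K` extends the pair of finite words `(e, q)`. -/
def Meets (K : Set ((ℕ → Fin 2) × (ℕ → ℕ))) (e : List (Fin 2)) (q : List ℕ) : Prop :=
  ∃ p ∈ K, OccursAt p.1 0 e ∧ OccursAt p.2 0 q

/-- The transitions of the automaton that guesses a witness for membership in the projection of
`K`; the state `none` does not verify anything. -/
inductive Step (K : Set ((ℕ → Fin 2) × (ℕ → ℕ))) :
    List (Fin 2) → Option (List ℕ) → List (Fin 2) → Option (List ℕ) → Prop
  | free (e e' : List (Fin 2)) : Step K e none e' none
  | guess (e e' : List (Fin 2)) (q : List ℕ) (k : ℕ) (hlt : e.length < e'.length)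
      (hpre : e <+: e') (hK : Meets K e' (q ++ [k])) : Step K e (some q) e' (some (q ++ [k]))

/-- The words that contain two consecutive blocks which do not code a node and its child, and the
words that lead from a cut in a block to a cut in a later block, along a transition. -/
def codedLanguage (K : Set ((ℕ → Fin 2) × (ℕ → ℕ))) : Language (Fin 2) :=
  {w | (∃ m m', ¬ IsChildLen m m' ∧ doubleBlock m m' <:+: w) ∨
    ∃ e o e' o', Admissible e o ∧ Admissible e' o' ∧ Step K e o e' o' ∧
      List.replicate (cutRight e o) 0 ++ [1] <+: w ∧ 1 :: List.replicate (cutLeft e' o') 0 <:+ w}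

theorem mem_codedLanguage {K : Set ((ℕ → Fin 2) × (ℕ → ℕ))} {w : List (Fin 2)} :
    w ∈ codedLanguage K ↔ (∃ m m', ¬ IsChildLen m m' ∧ doubleBlock m m' <:+: w) ∨
    ∃ e o e' o', Admissible e o ∧ Admissible e' o' ∧ Step K e o e' o' ∧
      List.replicate (cutRight e o) 0 ++ [1] <+: w ∧ 1 :: List.replicate (cutLeft e' o') 0 <:+ w :=
  Iff.rfl

theorem one_mem_of_mem_codedLanguage {K : Set ((ℕ → Fin 2) × (ℕ → ℕ))} {w : List (Fin 2)}
    (hw : w ∈ codedLanguage K) : (1 : Fin 2) ∈ w := by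
  rcases mem_codedLanguage.1 hw with ⟨m, m', -, h⟩ | ⟨e, o, e', o', -, -, -, h, -⟩
  · exact h.subset (by simp [doubleBlock])
  · exact h.subset (by simp)

theorem nil_notMem_codedLanguage {K : Set ((ℕ → Fin 2) × (ℕ → ℕ))} : [] ∉ codedLanguage K :=
  fun h => by simpa using one_mem_of_mem_codedLanguage h

/-! ### Sequences of blocks and the branch they code -/

section Blocks

variable {σ : ℕ → Fin 2}

theorem occursAt_zeros_one {p m : ℕ} : OccursAt σ p (List.replicate m 0 ++ [1]) ↔
    (∀ i < m, σ (p + i) = 0) ∧ σ (p + m) = 1 := by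
  rw [occursAt_append, occursAt_replicate, occursAt_singleton, List.length_replicate]

theorem occursAt_block {p m : ℕ} : OccursAt σ p (block m) ↔
    σ p = 1 ∧ OccursAt σ (p + 1) (List.replicate m 0 ++ [1]) := by
  rw [block, occursAt_cons]

theorem occursAt_doubleBlock {p m m' : ℕ} : OccursAt σ p (doubleBlock m m') ↔
    OccursAt σ p (block m) ∧ OccursAt σ (p + 1 + m) (block m') := by
  simp only [doubleBlock, block, occursAt_cons, occursAt_append, List.length_replicate,
    occursAt_nil]
  tauto

theorem occursAt_zeros_one_unique {p m m' : ℕ} (h : OccursAt σ p (List.replicate m 0 ++ [1]))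
    (h' : OccursAt σ p (List.replicate m' 0 ++ [1])) : m = m' := by
  rw [occursAt_zeros_one] at h h'
  by_contra hne
  rcases Nat.lt_or_gt_of_ne hne with hlt | hlt
  · exact absurd ((h'.1 m hlt).symm.trans h.2) (by decide)
  · exact absurd ((h.1 m' hlt).symm.trans h'.2) (by decide)

theorem occursAt_block_unique {p m m' : ℕ} (h : OccursAt σ p (block m))
    (h' : OccursAt σ p (block m')) : m = m' :=
  occursAt_zeros_one_unique (occursAt_block.1 h).2 (occursAt_block.1 h').2

theorem occursAt_block_add {p m m' : ℕ} (h : OccursAt σ p (1 :: List.replicate m 0))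
    (h' : OccursAt σ (p + 1 + m) (List.replicate m' 0 ++ [1])) :
    OccursAt σ p (block (m + m')) := by
  rw [block, List.replicate_add, List.append_assoc, ← List.cons_append, occursAt_append]
  refine ⟨h, ?_⟩
  convert h' using 1
  simp only [List.length_cons, List.length_replicate]
  omega

theorem OccursAt.of_block_add {p m m' : ℕ} (h : OccursAt σ p (block (m + m'))) :
    OccursAt σ p (1 :: List.replicate m 0) ∧
      OccursAt σ (p + 1 + m) (List.replicate m' 0 ++ [1]) := by
  rw [block, List.replicate_add, List.append_assoc, ← List.cons_append, occursAt_append] at h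
  refine ⟨h.1, ?_⟩
  convert h.2 using 1
  simp only [List.length_cons, List.length_replicate]
  omega

/-- `σ` has infinitely many letters `1`. -/
def InfinitelyManyOnes (σ : ℕ → Fin 2) : Prop := ∀ N, ∃ p, N ≤ p ∧ σ p = 1

/-- From position `N` on, consecutive blocks of `σ` code a node and one of its children. -/
def ProperFrom (σ : ℕ → Fin 2) (N : ℕ) : Prop :=
  ∀ p, N ≤ p → ∀ m m', OccursAt σ p (doubleBlock m m') → IsChildLen m m'

theorem InfinitelyManyOnes.exists_block (hσ : InfinitelyManyOnes σ) {p : ℕ} (hp : σ p = 1) :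
    ∃ m, OccursAt σ p (block m) := by
  have h : ∃ m, σ (p + 1 + m) = 1 := by
    obtain ⟨p', hp', h1⟩ := hσ (p + 1)
    exact ⟨p' - (p + 1), by rwa [Nat.add_sub_cancel' hp']⟩
  refine ⟨Nat.find h, occursAt_block.2 ⟨hp, occursAt_zeros_one.2 ⟨fun i hi => ?_, Nat.find_spec h⟩⟩⟩
  have := Nat.find_min h hi
  omega

theorem ProperFrom.exists_child {N p m : ℕ} (hσ : ProperFrom σ N) (hinf : InfinitelyManyOnes σ)
    (hp : N ≤ p) (h : OccursAt σ p (block m)) :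
    ∃ e b, m = blockLen e ∧ OccursAt σ (p + 1 + m) (block (blockLen (e ++ [b]))) := by
  obtain ⟨m', hm'⟩ := hinf.exists_block (occursAt_zeros_one.1 (occursAt_block.1 h).2).2
  obtain ⟨e, b, rfl, rfl⟩ := hσ p hp m m' (occursAt_doubleBlock.2 ⟨h, hm'⟩)
  exact ⟨e, b, rfl, hm'⟩

theorem ProperFrom.isPrefix {N p p' : ℕ} (hσ : ProperFrom σ N) (hinf : InfinitelyManyOnes σ)
    (hp : N ≤ p) {e e' : List (Fin 2)} (h : OccursAt σ p (block (blockLen e)))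
    (h' : OccursAt σ p' (block (blockLen e'))) (hpp : p ≤ p') : e <+: e' := by
  induction hn : p' - p using Nat.strong_induction_on generalizing p e with
  | _ n ih =>
  rcases hpp.eq_or_lt with rfl | hlt
  · rw [blockLen_injective (occursAt_block_unique h h')]
  obtain ⟨e₁, b, he, hb⟩ := hσ.exists_child hinf hp h
  obtain rfl := blockLen_injective he
  -- A block starts with a 1, so `p'` cannot fall among the zeros of the block at `p`.
  have hle : p + 1 + blockLen e ≤ p' := by
    by_contra hcon
    have h0 := (occursAt_zeros_one.1 (occursAt_block.1 h).2).1 (p' - (p + 1)) (by omega)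
    rw [Nat.add_sub_cancel' hlt, (occursAt_block.1 h').1] at h0
    exact absurd h0 (by decide)
  exact (List.prefix_append _ _).trans (ih (p' - (p + 1 + blockLen e)) (by omega)
    (by omega) hb hle rfl)

/-- Each proper block is followed by the block of a child, whose node is one letter longer. -/
theorem ProperFrom.exists_block_ge {N : ℕ} (hσ : ProperFrom σ N) (hinf : InfinitelyManyOnes σ)
    (P n : ℕ) : ∃ p e, P ≤ p ∧ n ≤ e.length ∧ OccursAt σ p (block (blockLen e)) := by
  suffices H : ∃ p e, max P N ≤ p ∧ n ≤ e.length ∧ OccursAt σ p (block (blockLen e)) by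
    obtain ⟨p, e, hp, he⟩ := H
    exact ⟨p, e, (le_max_left _ _).trans hp, he⟩
  induction n with
  | zero =>
    obtain ⟨p, hp, h1⟩ := hinf (max P N)
    obtain ⟨m, hm⟩ := hinf.exists_block h1
    obtain ⟨e, b, he, hb⟩ := hσ.exists_child hinf ((le_max_right _ _).trans hp) hm
    exact ⟨p, e, hp, Nat.zero_le _, he ▸ hm⟩
  | succ n ih =>
    obtain ⟨p, e, hp, hn, h⟩ := ih
    obtain ⟨e₁, b, he, hb⟩ := hσ.exists_child hinf ((le_max_right _ _).trans hp) h
    obtain rfl := blockLen_injective he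
    exact ⟨_, _, by omega, by simpa using hn, hb⟩

/-- `x` is the infinite branch of which the blocks of `σ` code finite prefixes. -/
def IsBranchOf (x σ : ℕ → Fin 2) : Prop :=
  ∀ p e, OccursAt σ p (block (blockLen e)) → OccursAt x 0 e

theorem ProperFrom.exists_isBranchOf (hσ : ProperFrom σ 0) (hinf : InfinitelyManyOnes σ) :
    ∃ x, IsBranchOf x σ := by
  refine (exists_limit_of_chain
    (ι := {e : List (Fin 2) // ∃ p, OccursAt σ p (block (blockLen e))}) (fun e => e.1) ?_
    ?_).imp fun x hx p e h => hx ⟨e, p, h⟩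
  · rintro ⟨e, p, h⟩ ⟨e', p', h'⟩ hle
    rcases le_total p p' with hp | hp
    · exact hσ.isPrefix hinf (Nat.zero_le _) h h' hp
    · have heq : e' = e := (hσ.isPrefix hinf (Nat.zero_le _) h' h hp).eq_of_length_le hle
      subst heq
      exact List.prefix_rfl
  · intro N
    obtain ⟨p, e, -, hN, h⟩ := hσ.exists_block_ge hinf 0 N
    exact ⟨⟨e, p, h⟩, hN⟩

end Blocks

/-! ### Factorizations as runs of the automaton -/

/-- `σ` starts with a cut block of the node `e` in the state `o`. -/
def StartsWith (σ : ℕ → Fin 2) (e : List (Fin 2)) (o : Option (List ℕ)) : Prop :=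
  Admissible e o ∧ OccursAt σ 0 (List.replicate (cutRight e o) 0 ++ [1])

/-- The branch `x` is accepted from the node `e` in the state `o`. -/
def AcceptsFrom (K : Set ((ℕ → Fin 2) × (ℕ → ℕ))) (e : List (Fin 2)) :
    Option (List ℕ) → (ℕ → Fin 2) → Prop
  | none, _ => True
  | some q, x => OccursAt x 0 e ∧ ∃ y, OccursAt y 0 q ∧ (x, y) ∈ K

theorem OccursAt.apply_eq {α : Type} {x x' : ℕ → α} {l : List α} (h : OccursAt x 0 l)
    (h' : OccursAt x' 0 l) {i : ℕ} (hi : i < l.length) : x i = x' i := by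
  have e := occursAt_iff_getElem.1 h i hi
  have e' := occursAt_iff_getElem.1 h' i hi
  rw [zero_add] at e e'
  rw [e, e']

theorem IsClosed.mem_of_meets {K : Set ((ℕ → Fin 2) × (ℕ → ℕ))} (hK : IsClosed K)
    {x : ℕ → Fin 2} {y : ℕ → ℕ} (h : ∀ N, ∃ e q, N ≤ e.length ∧ N ≤ q.length ∧
      OccursAt x 0 e ∧ OccursAt y 0 q ∧ Meets K e q) : (x, y) ∈ K := by
  choose e q he hq hx hy hm using h
  choose z hz hzx hzy using hm
  refine hK.mem_of_tendsto (b := Filter.atTop) (f := z) ?_ (.of_forall hz)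
  rw [Prod.tendsto_iff, tendsto_pi_nhds, tendsto_pi_nhds]
  refine ⟨fun i => tendsto_nhds_of_eventually_eq ?_, fun i => tendsto_nhds_of_eventually_eq ?_⟩
  · filter_upwards [Filter.eventually_gt_atTop i] with n hn
    exact (hzx n).apply_eq (hx n) (hn.trans_le (he n))
  · filter_upwards [Filter.eventually_gt_atTop i] with n hn
    exact (hzy n).apply_eq (hy n) (hn.trans_le (hq n))

section Runs

variable {K : Set ((ℕ → Fin 2) × (ℕ → ℕ))} {σ : ℕ → Fin 2}

theorem infinitelyManyOnes_of_mem (hσ : σ ∈ omegaPower (codedLanguage K)) :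
    InfinitelyManyOnes σ := by
  obtain ⟨w, n, -, h⟩ := (mem_omegaPower_iff nil_notMem_codedLanguage).1 hσ
  intro N
  have hn : N ≤ n N := by
    induction N with
    | zero => exact Nat.zero_le _
    | succ N ih =>
      have := List.length_pos_of_mem (one_mem_of_mem_codedLanguage (h N).1)
      have := (h N).2.2
      omega
  obtain ⟨i, hi, h1⟩ := List.getElem_of_mem (one_mem_of_mem_codedLanguage (h N).1)
  exact ⟨n N + i, by omega, by rw [occursAt_iff_getElem.1 (h N).2.1 i hi, h1]⟩

/-- An infinite run of the automaton along the blocks of `σ`. -/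
theorem acceptsFrom_of_run (hK : IsClosed K) {x : ℕ → Fin 2} {e : ℕ → List (Fin 2)}
    {o : ℕ → Option (List ℕ)} (hstep : ∀ i, Step K (e i) (o i) (e (i + 1)) (o (i + 1)))
    (hx : ∀ i, OccursAt x 0 (e (i + 1))) : AcceptsFrom K (e 0) (o 0) x := by
  cases h0 : o 0 with
  | none => trivial
  | some q₀ =>
    have hs : ∀ {e e' q o'}, Step K e (some q) e' o' → ∃ k, o' = some (q ++ [k]) ∧
        e.length < e'.length ∧ e <+: e' ∧ Meets K e' (q ++ [k]) := by
      intro e e' q o' h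
      cases h with
      | guess _ _ k hlt hpre hm => exact ⟨k, rfl, hlt, hpre, hm⟩
    have hsome : ∀ i, ∃ q, o i = some q := by
      intro i
      induction i with
      | zero => exact ⟨_, h0⟩
      | succ i ih =>
        obtain ⟨q, hq⟩ := ih
        obtain ⟨k, hk, -⟩ := hs (hq ▸ hstep i)
        exact ⟨_, hk⟩
    choose q hq using hsome
    obtain rfl : q 0 = q₀ := Option.some_injective _ ((hq 0).symm.trans h0)
    have hs' : ∀ i, ∃ k, q (i + 1) = q i ++ [k] ∧
        (e i).length < (e (i + 1)).length ∧ e i <+: e (i + 1) ∧ Meets K (e (i + 1)) (q (i + 1)) := by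
      intro i
      obtain ⟨k, hk, h⟩ := hs (hq i ▸ hstep i)
      have hqi := Option.some_injective _ ((hq (i + 1)).symm.trans hk)
      exact ⟨k, hqi, h.1, h.2.1, hqi ▸ h.2.2⟩
    choose k hk hlt hpre hm using hs'
    have hql : ∀ i, (q i).length = (q 0).length + i := by
      intro i
      induction i with
      | zero => rfl
      | succ i ih => rw [hk, List.length_append, ih, List.length_singleton, add_assoc]
    have hel : ∀ i, i ≤ (e i).length := by
      intro i
      induction i with
      | zero => exact Nat.zero_le _
      | succ i ih => exact Nat.succ_le_of_lt (ih.trans_lt (hlt i))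
    have hqpre : ∀ i j, i ≤ j → q i <+: q j := by
      intro i j hij
      induction hij with
      | refl => exact List.prefix_rfl
      | step _ ih => exact ih.trans (hk _ ▸ List.prefix_append _ _)
    obtain ⟨y, hy⟩ := exists_limit_of_chain q
      (fun i j h => hqpre i j (by rw [hql, hql j] at h; omega))
      (fun N => ⟨N, by rw [hql]; omega⟩)
    -- `hx` says nothing about `e 0`, whose block is cut at the start of the sequence; the prefix
    -- condition of the first transition ties it to `x`.
    refine ⟨(hx 0).prefix (hpre 0), y, hy 0, hK.mem_of_meets fun N => ?_⟩
    refine ⟨e (N + 1), q (N + 1), ?_, ?_, hx N, hy _, hm N⟩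
    · exact (Nat.le_succ N).trans (hel _)
    · rw [hql]; omega

/-- Properness excludes the words with an error. The end of each remaining word and the start of the
next fill one block, whose length identifies their node and state. -/
theorem exists_accepts_of_mem (hK : IsClosed K) (hσ : σ ∈ omegaPower (codedLanguage K))
    (hprop : ProperFrom σ 0) {x : ℕ → Fin 2} (hx : IsBranchOf x σ) :
    ∃ e o, StartsWith σ e o ∧ AcceptsFrom K e o x := by
  have hinf := infinitelyManyOnes_of_mem hσ
  obtain ⟨w, n, h0, h⟩ := (mem_omegaPower_iff nil_notMem_codedLanguage).1 hσ
  have hrun : ∀ i, ∃ e o e' o', Admissible e o ∧ Admissible e' o' ∧ Step K e o e' o' ∧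
      OccursAt σ (n i) (List.replicate (cutRight e o) 0 ++ [1]) ∧
      ∃ p, p + 1 + cutLeft e' o' = n (i + 1) ∧
        OccursAt σ p (1 :: List.replicate (cutLeft e' o') 0) := by
    intro i
    obtain ⟨hw, hocc, hn⟩ := h i
    rcases mem_codedLanguage.1 hw with ⟨m, m', hm, hmw⟩ | ⟨e, o, e', o', ha, ha', hs, hp, hsuf⟩
    · obtain ⟨p, -, -, hp⟩ := hocc.exists_of_isInfix hmw
      exact absurd (hprop p (Nat.zero_le _) _ _ hp) hm
    · obtain ⟨p, -, hp2, hp3⟩ := hocc.exists_of_isSuffix hsuf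
      refine ⟨e, o, e', o', ha, ha', hs, hocc.prefix hp, p, ?_, hp3⟩
      rw [hn, ← hp2, List.length_cons, List.length_replicate]
      omega
  choose e o e' o' ha ha' hs hpre p hpn hp using hrun
  have hmatch : ∀ i, e' i = e (i + 1) ∧ o' i = o (i + 1) ∧
      OccursAt σ (p i) (block (blockLen (e (i + 1)))) := by
    intro i
    have hb := occursAt_block_add (hp i) (by rw [hpn]; exact hpre (i + 1))
    -- The child is irrelevant here; what matters is that the recomposed length is some `blockLen
    -- r`.
    obtain ⟨r, b, hr, -⟩ := hprop.exists_child hinf (Nat.zero_le _) hb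
    obtain ⟨h1, h2, h3⟩ := eq_of_cutLeft_add_cutRight (ha' i) (ha (i + 1)) hr
    rw [hr] at hb
    exact ⟨h1.trans h2.symm, h3, by rwa [h2]⟩
  refine ⟨e 0, o 0, ⟨ha 0, by simpa [h0] using hpre 0⟩, acceptsFrom_of_run hK (fun i => ?_)
    fun i => hx _ _ (hmatch i).2.2⟩
  have := hs i
  rwa [(hmatch i).1, (hmatch i).2.1] at this

theorem exists_factor_mem_of_step {e e' : List (Fin 2)} {o o' : Option (List ℕ)}
    (ha : Admissible e o) (ha' : Admissible e' o') (hs : Step K e o e' o') {p p' : ℕ}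
    (hp : OccursAt σ p (List.replicate (cutRight e o) 0 ++ [1]))
    (hp' : OccursAt σ p' (block (blockLen e'))) (hle : p + cutRight e o ≤ p') :
    ∃ n, factor σ p n ∈ codedLanguage K ∧
      OccursAt σ (p + n) (List.replicate (cutRight e' o') 0 ++ [1]) := by
  rw [← cutLeft_add_cutRight ha'] at hp'
  obtain ⟨h1, h2⟩ := hp'.of_block_add
  refine ⟨p' + 1 + cutLeft e' o' - p, mem_codedLanguage.2 (.inr ⟨e, o, e', o', ha, ha', hs, ?_, ?_⟩),
    ?_⟩
  · refine hp.isPrefix_factor ?_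
    simp only [List.length_append, List.length_replicate, List.length_singleton]
    omega
  · refine h1.isSuffix_factor (by omega) ?_
    simp only [List.length_cons, List.length_replicate]
    omega
  · rwa [Nat.add_sub_cancel' (by omega)]

theorem exists_factor_mem_of_free {N p : ℕ} (hinf : InfinitelyManyOnes σ) (hσ : ProperFrom σ N)
    {e : List (Fin 2)} (hp : OccursAt σ p (List.replicate (cutRight e none) 0 ++ [1])) :
    ∃ n, factor σ p n ∈ codedLanguage K ∧
      ∃ e', OccursAt σ (p + n) (List.replicate (cutRight e' none) 0 ++ [1]) := by
  obtain ⟨p', e', hp', -, hb⟩ := hσ.exists_block_ge hinf (p + cutRight e none) 0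
  obtain ⟨n, hn, hocc⟩ := exists_factor_mem_of_step (admissible_none e) (admissible_none e')
    (.free e e') hp hb hp'
  exact ⟨n, hn, e', hocc⟩

theorem mem_of_startsWith (hinf : InfinitelyManyOnes σ) (hσ : ProperFrom σ 0)
    {x : ℕ → Fin 2} (hx : IsBranchOf x σ) {e : List (Fin 2)} {o : Option (List ℕ)}
    (hstart : StartsWith σ e o) (hacc : AcceptsFrom K e o x) :
    σ ∈ omegaPower (codedLanguage K) := by
  cases o with
  | none =>
    exact mem_omegaPower_of_step nil_notMem_codedLanguage
      (fun p => ∃ e, OccursAt σ p (List.replicate (cutRight e none) 0 ++ [1])) ⟨e, hstart.2⟩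
      fun p ⟨e, hp⟩ => exists_factor_mem_of_free hinf hσ hp
  | some q =>
    obtain ⟨hxe, y, hyq, hK⟩ := hacc
    refine mem_omegaPower_of_step nil_notMem_codedLanguage
      (fun p => ∃ e q, Admissible e (some q) ∧ OccursAt x 0 e ∧ OccursAt y 0 q ∧
        OccursAt σ p (List.replicate (cutRight e (some q)) 0 ++ [1]))
      ⟨e, q, hstart.1, hxe, hyq, hstart.2⟩ ?_
    rintro p ⟨e, q, ha, hxe, hyq, hp⟩
    have hyq' : OccursAt y 0 (q ++ [y q.length]) :=
      occursAt_append.2 ⟨hyq, occursAt_singleton.2 (by rw [zero_add])⟩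
    -- The run reads one more coordinate of `y`, but waits for a node that is longer than `e` and
    -- long enough to make the new state admissible.
    obtain ⟨p', e', hp', hlen, hb⟩ := hσ.exists_block_ge hinf (p + cutRight e (some q))
      (e.length + 1 + encode (some (q ++ [y q.length])))
    have hxe' := hx _ _ hb
    have ha' : Admissible e' (some (q ++ [y q.length])) := by
      have := length_le_encode e'
      unfold Admissible
      omega
    obtain ⟨n, hn, hocc⟩ := exists_factor_mem_of_step ha ha'
      (.guess e e' q _ (by omega) (hxe.isPrefix hxe' (by omega)) ⟨(x, y), hK, hxe', hyq'⟩)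
      hp hb hp'
    exact ⟨n, hn, e', _, ha', hxe', hyq', hocc⟩

/-- If errors recur forever, each word runs past one more error. Otherwise a single word runs past
an error into the proper part, stops at a cut for `none`, and free transitions take over. -/
theorem mem_of_not_properFrom (hinf : InfinitelyManyOnes σ) (hσ : ¬ ProperFrom σ 0) :
    σ ∈ omegaPower (codedLanguage K) := by
  have hbad : ∀ {N}, ¬ ProperFrom σ N → ∃ p m m', N ≤ p ∧ ¬ IsChildLen m m' ∧
      OccursAt σ p (doubleBlock m m') := by
    intro N h
    unfold ProperFrom at h
    push Not at h
    obtain ⟨p, hp, m, m', h1, h2⟩ := h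
    exact ⟨p, m, m', hp, h2, h1⟩
  by_cases hall : ∀ N, ¬ ProperFrom σ N
  · refine mem_omegaPower_of_step nil_notMem_codedLanguage (fun _ => True) trivial fun P _ => ?_
    obtain ⟨p, m, m', hp, hm, hocc⟩ := hbad (hall P)
    refine ⟨p + (doubleBlock m m').length - P, mem_codedLanguage.2 (.inl ⟨m, m', hm, ?_⟩), trivial⟩
    exact hocc.isInfix_factor hp (by omega)
  · push Not at hall
    obtain ⟨N, hN⟩ := hall
    refine mem_omegaPower_of_step nil_notMem_codedLanguage
      (fun p => p = 0 ∨ ∃ e, OccursAt σ p (List.replicate (cutRight e none) 0 ++ [1]))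
      (.inl rfl) ?_
    rintro p (rfl | ⟨e, hp⟩)
    · obtain ⟨p, m, m', -, hm, hocc⟩ := hbad hσ
      obtain ⟨p', e, hp', -, hb⟩ := hN.exists_block_ge hinf (p + (doubleBlock m m').length) 0
      rw [← cutLeft_add_cutRight (admissible_none e)] at hb
      refine ⟨p' + 1 + cutLeft e none, mem_codedLanguage.2 (.inl ⟨m, m', hm, ?_⟩), .inr ⟨e, ?_⟩⟩
      · exact hocc.isInfix_factor (Nat.zero_le _) (by omega)
      · rw [zero_add]
        exact hb.of_block_add.2
    · obtain ⟨n, hn, h⟩ := exists_factor_mem_of_free hinf hN hp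
      exact ⟨n, hn, .inr h⟩

end Runs

/-! ### The reduction of the projection of K -/

section Encoding

/-- The positions of the letters `1` in the encoding of `x`. -/
def blockPos (x : ℕ → Fin 2) : ℕ → ℕ
  | 0 => cutRight [] (some [])
  | j + 1 => blockPos x j + 1 + blockLen (factor x 0 (j + 1))

open Classical in
/-- The infinite word made of the end of the block of the empty word and of the blocks of the
nonempty finite prefixes of `x`. -/
noncomputable def encodeSeq (x : ℕ → Fin 2) (k : ℕ) : Fin 2 :=
  if ∃ j, blockPos x j = k then 1 else 0

theorem blockPos_strictMono (x : ℕ → Fin 2) : StrictMono (blockPos x) :=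
  strictMono_nat_of_lt_succ fun j => by rw [blockPos]; omega

theorem encodeSeq_eq_one {x : ℕ → Fin 2} {k : ℕ} :
    encodeSeq x k = 1 ↔ ∃ j, blockPos x j = k := by
  simp [encodeSeq]

theorem encodeSeq_eq_zero {x : ℕ → Fin 2} {k : ℕ} :
    encodeSeq x k = 0 ↔ ¬ ∃ j, blockPos x j = k := by
  simp [encodeSeq]

theorem infinitelyManyOnes_encodeSeq (x : ℕ → Fin 2) : InfinitelyManyOnes (encodeSeq x) :=
  fun N => ⟨_, (blockPos_strictMono x).le_apply, encodeSeq_eq_one.2 ⟨N, rfl⟩⟩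

theorem occursAt_encodeSeq_zero (x : ℕ → Fin 2) :
    OccursAt (encodeSeq x) 0 (List.replicate (cutRight [] (some [])) 0 ++ [1]) := by
  refine occursAt_zeros_one.2 ⟨fun i hi => encodeSeq_eq_zero.2 ?_,
    encodeSeq_eq_one.2 ⟨0, by rw [blockPos, zero_add]⟩⟩
  rintro ⟨j, hj⟩
  have := (blockPos_strictMono x).monotone (Nat.zero_le j)
  rw [hj, blockPos] at this
  omega

theorem occursAt_encodeSeq_block (x : ℕ → Fin 2) (j : ℕ) :
    OccursAt (encodeSeq x) (blockPos x j) (block (blockLen (factor x 0 (j + 1)))) := by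
  refine occursAt_block.2 ⟨encodeSeq_eq_one.2 ⟨j, rfl⟩, occursAt_zeros_one.2
    ⟨fun i hi => encodeSeq_eq_zero.2 ?_, encodeSeq_eq_one.2 ⟨j + 1, rfl⟩⟩⟩
  rintro ⟨k, hk⟩
  have h1 : blockPos x j < blockPos x k := by omega
  have h2 : blockPos x k < blockPos x (j + 1) := by rw [blockPos, hk]; omega
  rw [(blockPos_strictMono x).lt_iff_lt] at h1 h2
  omega

theorem properFrom_encodeSeq (x : ℕ → Fin 2) : ProperFrom (encodeSeq x) 0 := by
  intro p _ m m' h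
  obtain ⟨h1, h2⟩ := occursAt_doubleBlock.1 h
  obtain ⟨j, rfl⟩ := encodeSeq_eq_one.1 (occursAt_block.1 h1).1
  obtain rfl := occursAt_block_unique h1 (occursAt_encodeSeq_block x j)
  have := occursAt_block_unique h2 (occursAt_encodeSeq_block x (j + 1))
  exact ⟨_, x (j + 1), rfl, by rw [this, factor_add x 0 (j + 1) 1]; simp [factor]⟩

theorem isBranchOf_encodeSeq (x : ℕ → Fin 2) : IsBranchOf x (encodeSeq x) := by
  intro p e h
  obtain ⟨j, rfl⟩ := encodeSeq_eq_one.1 (occursAt_block.1 h).1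
  rw [blockLen_injective (occursAt_block_unique h (occursAt_encodeSeq_block x j))]
  exact occursAt_factor _ _ _

theorem admissible_nil : Admissible [] (some []) := by
  simp [Admissible]

theorem startsWith_unique {σ : ℕ → Fin 2} {e e' : List (Fin 2)} {o o' : Option (List ℕ)}
    (h : StartsWith σ e o) (h' : StartsWith σ e' o') : e = e' ∧ o = o' := by
  have hc := occursAt_zeros_one_unique h.2 h'.2
  have := cutLeft_add_cutRight h.1
  rw [hc] at this
  obtain ⟨-, h2, h3⟩ := eq_of_cutLeft_add_cutRight h.1 h'.1 this
  exact ⟨h2.symm, h3⟩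

theorem continuous_encodeSeq : Continuous encodeSeq := by
  refine continuous_of_agree fun k => ⟨k + 1, fun x x' h => ?_⟩
  have hpos : ∀ j ≤ k + 1, blockPos x j = blockPos x' j := by
    intro j hj
    induction j with
    | zero => rfl
    | succ j ih =>
      rw [blockPos, blockPos, ih (by omega), factor_congr fun i hi => h i (by omega)]
  have hiff : (∃ j, blockPos x j = k) ↔ ∃ j, blockPos x' j = k := by
    constructor
    · rintro ⟨j, hj⟩
      have := (blockPos_strictMono x).le_apply (x := j)
      exact ⟨j, by rw [← hpos j (by omega), hj]⟩
    · rintro ⟨j, hj⟩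
      have := (blockPos_strictMono x').le_apply (x := j)
      exact ⟨j, by rw [hpos j (by omega), hj]⟩
  by_cases hj : ∃ j, blockPos x' j = k
  · rw [encodeSeq_eq_one.2 hj, encodeSeq_eq_one.2 (hiff.2 hj)]
  · rw [encodeSeq_eq_zero.2 hj, encodeSeq_eq_zero.2 (mt hiff.1 hj)]

/-- The opening zeros force the initial node `[]` and state `some []`, which constrain neither `x`
nor the witness. -/
theorem encodeSeq_mem_iff {K : Set ((ℕ → Fin 2) × (ℕ → ℕ))} (hK : IsClosed K) (x : ℕ → Fin 2) :
    encodeSeq x ∈ omegaPower (codedLanguage K) ↔ ∃ y, (x, y) ∈ K := by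
  have hstart : StartsWith (encodeSeq x) [] (some []) :=
    ⟨admissible_nil, occursAt_encodeSeq_zero x⟩
  constructor
  · intro h
    obtain ⟨e, o, hs, ha⟩ :=
      exists_accepts_of_mem hK h (properFrom_encodeSeq x) (isBranchOf_encodeSeq x)
    obtain ⟨rfl, rfl⟩ := startsWith_unique hs hstart
    obtain ⟨-, y, -, hy⟩ := ha
    exact ⟨y, hy⟩
  · rintro ⟨y, hy⟩
    exact mem_of_startsWith (infinitelyManyOnes_encodeSeq x) (properFrom_encodeSeq x)
      (isBranchOf_encodeSeq x) hstart ⟨occursAt_nil _ _, y, occursAt_nil _ _, hy⟩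

end Encoding

/-! ### Borel class of the coded ω-powers -/

section Complexity

theorem isPi0_two_infinitelyManyOnes : IsPi0 2 {σ | InfinitelyManyOnes σ} := by
  refine (isPi0_iff le_rfl _).2 ⟨fun _ => 1, fun N => ⋃ p ≥ N, {σ | OccursAt σ p [1]},
    fun N => ⟨le_rfl, by exact_mod_cast one_lt_two, (isSigma0_one_iff _).2 ?_⟩, ?_⟩
  · exact isOpen_biUnion fun p _ => (isClopen_occursAt p _).2
  · ext σ
    simp [InfinitelyManyOnes, occursAt_singleton]

theorem isOpen_not_properFrom : IsOpen {σ : ℕ → Fin 2 | ¬ ProperFrom σ 0} := by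
  have : {σ : ℕ → Fin 2 | ¬ ProperFrom σ 0} = ⋃ p, ⋃ m, ⋃ m', ⋃ _ : ¬ IsChildLen m m',
      {σ | OccursAt σ p (doubleBlock m m')} := by
    ext σ
    simp only [ProperFrom, Set.mem_ofPred_eq, Set.mem_iUnion]
    push Not
    exact exists_congr fun p => by
      simp only [Nat.zero_le, true_and]
      exact exists_congr fun m => exists_congr fun m' => by
        rw [and_comm, exists_prop]
  rw [this]
  exact isOpen_iUnion fun p => isOpen_iUnion fun m => isOpen_iUnion fun m' =>
    isOpen_iUnion fun _ => (isClopen_occursAt p _).2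

theorem isClopen_startsWith (e : List (Fin 2)) (o : Option (List ℕ)) :
    IsClopen {σ | StartsWith σ e o} := by
  by_cases h : Admissible e o
  · simpa [StartsWith, h] using isClopen_occursAt 0 (List.replicate (cutRight e o) 0 ++ [1])
  · simp [StartsWith, h, isClopen_empty]

/-- Coordinate k of the branch is read off any single block whose node is longer than k, so its
value is an open condition. -/
theorem exists_continuous_branch :
    ∃ g : {σ : ℕ → Fin 2 | InfinitelyManyOnes σ ∧ ProperFrom σ 0} → ℕ → Fin 2,
      Continuous g ∧ ∀ σ, IsBranchOf (g σ) σ.1 := by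
  choose g hg using fun σ : {σ : ℕ → Fin 2 | InfinitelyManyOnes σ ∧ ProperFrom σ 0} =>
    σ.2.2.exists_isBranchOf σ.2.1
  refine ⟨g, continuous_pi fun k => continuous_discrete_rng.2 fun b => ?_, hg⟩
  have : (fun σ => g σ k) ⁻¹' {b} = Subtype.val ⁻¹' ⋃ p, ⋃ e, ⋃ _ : e[k]? = some b,
      {σ : ℕ → Fin 2 | OccursAt σ p (block (blockLen e))} := by
    ext σ
    simp only [Set.mem_preimage, Set.mem_singleton_iff, Set.mem_iUnion, Set.mem_ofPred_eq]
    constructor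
    · rintro rfl
      obtain ⟨p, e, -, hlen, h⟩ := σ.2.2.exists_block_ge σ.2.1 0 (k + 1)
      have := occursAt_iff_getElem.1 (hg σ p e h) k hlen
      exact ⟨p, e, by rw [List.getElem?_eq_getElem hlen, ← this, zero_add], h⟩
    · rintro ⟨p, e, he, h⟩
      obtain ⟨hk, rfl⟩ := List.getElem?_eq_some_iff.1 he
      have := occursAt_iff_getElem.1 (hg σ p e h) k hk
      rwa [zero_add] at this
  rw [this]
  refine IsOpen.preimage continuous_subtype_val ?_
  exact isOpen_iUnion fun p => isOpen_iUnion fun e => isOpen_iUnion fun _ =>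
    (isClopen_occursAt p _).2

/-- The sets `S i` matter only on the domain of the branch map: finitely many ones excludes a
sequence, and infinitely many ones with an error includes it. -/
theorem omegaPower_codedLanguage_eq {K : Set ((ℕ → Fin 2) × (ℕ → ℕ))} (hK : IsClosed K)
    {Γ : Set (ℕ → Fin 2) → Prop}
    (hsub : ∀ (D : Set (ℕ → Fin 2)) (g : D → ℕ → Fin 2), Continuous g → ∀ A, Γ A →
      ∃ S, Γ S ∧ g ⁻¹' A = Subtype.val ⁻¹' S)
    (hΓ : ∀ e o, Γ {x | AcceptsFrom K e o x}) :
    ∃ S : List (Fin 2) × Option (List ℕ) → Set (ℕ → Fin 2), (∀ i, Γ (S i)) ∧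
      omegaPower (codedLanguage K) = {σ | InfinitelyManyOnes σ} ∩ ({σ | ¬ ProperFrom σ 0} ∪
        ⋃ i, {σ | StartsWith σ i.1 i.2} ∩ S i) := by
  obtain ⟨g, hg, hbr⟩ := exists_continuous_branch
  choose S hS hgS using fun i : List (Fin 2) × Option (List ℕ) =>
    hsub _ g hg _ (hΓ i.1 i.2)
  refine ⟨S, hS, ?_⟩
  have hiff : ∀ (i : List (Fin 2) × Option (List ℕ)) σ, AcceptsFrom K i.1 i.2 (g σ) ↔
      σ.1 ∈ S i := fun i σ => by
    have := congrArg (σ ∈ ·) (hgS i)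
    exact this.to_iff
  ext σ
  simp only [Set.mem_inter_iff, Set.mem_union, Set.mem_iUnion, Set.mem_ofPred_eq]
  constructor
  · intro h
    have hinf := infinitelyManyOnes_of_mem h
    refine ⟨hinf, or_iff_not_imp_left.2 fun hp => ?_⟩
    rw [not_not] at hp
    obtain ⟨e, o, hs, ha⟩ := exists_accepts_of_mem hK h hp (hbr ⟨σ, hinf, hp⟩)
    exact ⟨(e, o), hs, (hiff (e, o) _).1 ha⟩
  · rintro ⟨hinf, h⟩
    by_cases hp : ProperFrom σ 0
    · obtain ⟨i, hs, hi⟩ := h.resolve_left (not_not.2 hp)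
      exact mem_of_startsWith hinf hp (hbr ⟨σ, hinf, hp⟩) hs ((hiff i ⟨σ, hinf, hp⟩).2 hi)
    · exact mem_of_not_properFrom hinf hp

theorem setOf_acceptsFrom_some (K : Set ((ℕ → Fin 2) × (ℕ → ℕ))) (e : List (Fin 2))
    (q : List ℕ) : {x | AcceptsFrom K e (some q) x} = {x | OccursAt x 0 e} ∩
      constrainedProj K (Finset.range q.length) fun i => q.getD i 0 := by
  ext x
  refine and_congr Iff.rfl (exists_congr fun y => and_congr ?_ Iff.rfl)
  rw [occursAt_iff_getElem]
  simp only [zero_add, Finset.mem_range]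
  exact forall₂_congr fun i hi => by rw [List.getD_eq_getElem _ _ hi]

theorem exists_omegaPower_pi0 {ξ : Ordinal.{0}} (h2 : 2 ≤ ξ) {P : Set (ℕ → Fin 2)}
    (hP : IsPi0 ξ P) :
    ∃ L : Language (Fin 2), IsPi0 ξ (omegaPower L) ∧ IsWadgeReducible P (omegaPower L) := by
  have h1 : 1 ≤ ξ := IsSigma0.one_le hP
  have hlt : 1 < ξ := lt_of_lt_of_le (by exact_mod_cast one_lt_two) h2
  obtain ⟨K, hK, hproj, hPK⟩ := (hasClosedWitness_sigma0_and_pi0 ξ P).2 hP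
  refine ⟨codedLanguage K, ?_, encodeSeq, continuous_encodeSeq, ?_⟩
  · obtain ⟨S, hS, h⟩ := omegaPower_codedLanguage_eq hK (Γ := IsPi0 ξ)
      (fun D g hg A hA => by
        obtain ⟨S, hS, h⟩ := (hA.preimage hg).exists_subtype
        exact ⟨S, hS, h⟩)
      (fun e o => by
        cases o with
        | none => exact isClosed_univ.isPi0 h1
        | some q =>
          rw [setOf_acceptsFrom_some]
          exact ((isClopen_occursAt 0 e).1.isPi0 h1).inter (hproj _ _))
    -- At most one pair starts a given sequence, so the union can be rewritten as an intersection
    -- over all pairs, under which Π⁰_ξ is closed.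
    have hU : (⋃ i : List (Fin 2) × Option (List ℕ), {σ | StartsWith σ i.1 i.2} ∩ S i) =
        (⋃ i : List (Fin 2) × Option (List ℕ), {σ | StartsWith σ i.1 i.2}) ∩
          ⋂ i : List (Fin 2) × Option (List ℕ), ({σ | StartsWith σ i.1 i.2}ᶜ ∪ S i) := by
      ext σ
      simp only [Set.mem_inter_iff, Set.mem_union, Set.mem_iUnion, Set.mem_iInter,
        Set.mem_compl_iff, Set.mem_ofPred_eq]
      constructor
      · rintro ⟨i, hs, hi⟩
        refine ⟨⟨i, hs⟩, fun j => or_iff_not_imp_left.2 fun hj => ?_⟩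
        obtain ⟨e1, e2⟩ := startsWith_unique hs (not_not.1 hj)
        rwa [← Prod.ext e1 e2]
      · rintro ⟨⟨i, hs⟩, h⟩
        exact ⟨i, hs, (h i).resolve_left (not_not.2 hs)⟩
    have hopen : ∀ {U : Set (ℕ → Fin 2)}, IsOpen U → IsPi0 ξ U := fun hU =>
      ((isSigma0_one_iff _).2 hU).isPi0_of_lt le_rfl hlt
    rw [h, hU]
    refine (isPi0_two_infinitelyManyOnes.mono h2).inter ((hopen isOpen_not_properFrom).union
      (.inter (hopen ?_) (.iInter_countable h1 fun i => .union (hopen ?_) (hS i))))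
    · exact isOpen_iUnion fun i => (isClopen_startsWith _ _).2
    · exact (isClopen_startsWith _ _).1.isOpen_compl
  · ext x
    exact (hPK x).trans (encodeSeq_mem_iff hK x).symm

theorem exists_omegaPower_sigma0 {ξ : Ordinal.{0}} (h2 : 2 < ξ) {P : Set (ℕ → Fin 2)}
    (hP : IsSigma0 ξ P) :
    ∃ L : Language (Fin 2), IsSigma0 ξ (omegaPower L) ∧ IsWadgeReducible P (omegaPower L) := by
  have h1 : 1 ≤ ξ := hP.one_le
  obtain ⟨K, hK, hproj, hPK⟩ := (hasClosedWitness_sigma0_and_pi0 ξ P).1 hP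
  refine ⟨codedLanguage K, ?_, encodeSeq, continuous_encodeSeq, ?_⟩
  · obtain ⟨S, hS, h⟩ := omegaPower_codedLanguage_eq hK (Γ := IsSigma0 ξ)
      (fun D g hg A hA => by
        obtain ⟨S, hS, h⟩ := (hA.preimage hg).exists_subtype
        exact ⟨S, hS, h⟩)
      (fun e o => by
        cases o with
        | none => exact isOpen_univ.isSigma0 h1
        | some q =>
          rw [setOf_acceptsFrom_some]
          exact ((isClopen_occursAt 0 e).2.isSigma0 h1).inter (hproj _ _))
    rw [h]
    refine (isPi0_two_infinitelyManyOnes.isSigma0_of_lt (by exact_mod_cast one_le_two) h2).inter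
      ((isOpen_not_properFrom.isSigma0 h1).union (.iUnion_countable h1 fun i => ?_))
    exact ((isClopen_startsWith _ _).2.isSigma0 h1).inter (hS i)
  · ext x
    exact (hPK x).trans (encodeSeq_mem_iff hK x).symm

end Complexity

/-! ### Explicit languages for Π⁰_1 and Σ⁰_1 -/

section LevelOne

theorem omegaPower_singleton_zero : omegaPower ({[0]} : Language (Fin 2)) = {0} := by
  have hnil : ([] : List (Fin 2)) ∉ ({[0]} : Language (Fin 2)) := fun h => by
    simpa using Set.mem_singleton_iff.1 h
  ext σ
  rw [Set.mem_singleton_iff]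
  constructor
  · intro h
    obtain ⟨w, n, h0, h⟩ := (mem_omegaPower_iff hnil).1 h
    have hw : ∀ i, w i = [0] := fun i => Set.mem_singleton_iff.1 (h i).1
    have hn : ∀ i, n i = i := by
      intro i
      induction i with
      | zero => exact h0
      | succ i ih => rw [(h i).2.2, ih, hw]; rfl
    funext i
    have := (h i).2.1
    rw [hw, hn, occursAt_singleton] at this
    exact this
  · rintro rfl
    exact mem_omegaPower_of_step hnil (fun _ => True) trivial
      fun p _ => ⟨1, Set.mem_singleton_iff.2 rfl, trivial⟩

/-- The words that start with `0` or with some `1 0^k 1`. -/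
def openLanguage : Language (Fin 2) := {w | [0] <+: w ∨ ∃ k, block k <+: w}

theorem mem_openLanguage {w : List (Fin 2)} :
    w ∈ openLanguage ↔ [0] <+: w ∨ ∃ k, block k <+: w := Iff.rfl

theorem nil_notMem_openLanguage : [] ∉ openLanguage := by
  rw [mem_openLanguage]
  simp [block]

/-- Only the first word is a genuine condition. It can be prolonged up to a later 0, or into a tail
of ones where `block 0`, the word 11, is available; either way the factorization continues. Only
1000… is left out. -/
theorem mem_omegaPower_openLanguage {σ : ℕ → Fin 2} :
    σ ∈ omegaPower openLanguage ↔ σ 0 = 0 ∨ ∃ i, σ (i + 1) = 1 := by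
  constructor
  · intro h
    obtain ⟨w, n, h0, h⟩ := (mem_omegaPower_iff nil_notMem_openLanguage).1 h
    obtain ⟨hw, hocc, -⟩ := h 0
    rw [h0] at hocc
    rcases hw with hw | ⟨k, hk⟩
    · exact .inl (occursAt_singleton.1 (hocc.prefix hw))
    · have := (occursAt_zeros_one.1 (occursAt_block.1 (hocc.prefix hk)).2).2
      exact .inr ⟨k, by rwa [zero_add, add_comm] at this⟩
  · intro h
    have hcut : ∀ M, ∃ p, M ≤ p ∧ (σ p = 0 ∨ ∀ i, p ≤ i → σ i = 1) := by
      intro M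
      by_cases hM : ∃ p, M ≤ p ∧ σ p = 0
      · obtain ⟨p, hp, h0⟩ := hM
        exact ⟨p, hp, .inl h0⟩
      · push Not at hM
        exact ⟨M, le_rfl, .inr fun i hi => by have := hM i hi; omega⟩
    have hstep : ∀ p l, OccursAt σ p l → ([0] <+: l ∨ ∃ k, block k <+: l) →
        ∃ n, factor σ p n ∈ openLanguage ∧
          (p + n = 0 ∨ σ (p + n) = 0 ∨ ∀ i, p + n ≤ i → σ i = 1) := by
      intro p l hl hlp
      obtain ⟨p', hp', hc⟩ := hcut (p + l.length)
      have hpre : l <+: factor σ p (p' - p) := hl.isPrefix_factor (by omega)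
      refine ⟨p' - p, hlp.imp (fun h => h.trans hpre) fun ⟨k, h⟩ => ⟨k, h.trans hpre⟩, .inr ?_⟩
      rwa [Nat.add_sub_cancel' (by omega)]
    refine mem_omegaPower_of_step nil_notMem_openLanguage
      (fun p => p = 0 ∨ σ p = 0 ∨ ∀ i, p ≤ i → σ i = 1) (.inl rfl) ?_
    have hzero : ∀ p, σ p = 0 → _ := fun p hp =>
      hstep p [0] (occursAt_singleton.2 hp) (.inl List.prefix_rfl)
    rintro p (rfl | hp | hp)
    · by_cases h0 : σ 0 = 0
      · exact hzero 0 h0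
      · have h1 := h.resolve_left h0
        refine hstep 0 (block (Nat.find h1)) (occursAt_block.2 ⟨by omega, occursAt_zeros_one.2
          ⟨fun i hi => ?_, ?_⟩⟩) (.inr ⟨_, List.prefix_rfl⟩)
        · have := Nat.find_min h1 hi
          rw [zero_add, add_comm]
          omega
        · rw [zero_add, add_comm]
          exact Nat.find_spec h1
    · exact hzero p hp
    · exact hstep p (block 0) (occursAt_block.2 ⟨hp p le_rfl, occursAt_zeros_one.2
        ⟨fun i hi => absurd hi (Nat.not_lt_zero i), hp _ (by omega)⟩⟩) (.inr ⟨0, List.prefix_rfl⟩)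

theorem isCompleteFor_omegaPower_openLanguage :
    IsCompleteFor (fun X _ => IsSigma0 (X := X) 1) (omegaPower openLanguage) := by
  refine isCompleteFor_pi0_one.compl_pi0.of_reducible ?_ ?_
  · refine (isSigma0_one_iff _).2 ?_
    have : omegaPower openLanguage =
        {σ | OccursAt σ 0 [0]} ∪ ⋃ i, {σ | OccursAt σ (i + 1) [1]} := by
      ext σ
      simp [mem_omegaPower_openLanguage, occursAt_singleton]
    rw [this]
    exact (isClopen_occursAt _ _).2.union (isOpen_iUnion fun i => (isClopen_occursAt _ _).2)
  · refine ⟨fun x i => Nat.casesOn i 1 x, continuous_pi fun i => ?_, ?_⟩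
    · cases i with
      | zero => exact continuous_const
      | succ i => exact continuous_apply i
    · ext x
      rw [Set.mem_preimage, mem_omegaPower_openLanguage, Set.mem_compl_iff,
        Set.mem_singleton_iff, funext_iff, not_forall]
      refine Iff.trans (exists_congr fun i => ?_) (or_iff_right one_ne_zero).symm
      rw [Pi.zero_apply]
      change ¬ x i = 0 ↔ x i = 1
      omega

end LevelOne

/-! ### An explicit language for Σ⁰_2 -/

section LevelTwo

/-- The words that do not occur in a concatenation of blocks `1 0` and `1 0 0 0`. -/
def forbiddenWords : Set (List (Fin 2)) := {[1, 1], [1, 0, 0, 1], [0, 0, 0, 0]}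

/-- A language whose `ω`-power contains a sequence of blocks `1 0` and `1 0 0 0` if and only if
the block `1 0 0 0` occurs finitely many times. -/
def fSigmaLanguage : Language (Fin 2) :=
  {w | (∃ f ∈ forbiddenWords, f <:+: w) ∨ ([1] <+: w ∧ [1] <:+ w) ∨ w = [0, 1] ∨
    ([0, 0, 1] <+: w ∧ [1, 0] <:+ w)}

theorem mem_fSigmaLanguage {w : List (Fin 2)} : w ∈ fSigmaLanguage ↔
    (∃ f ∈ forbiddenWords, f <:+: w) ∨ ([1] <+: w ∧ [1] <:+ w) ∨ w = [0, 1] ∨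
    ([0, 0, 1] <+: w ∧ [1, 0] <:+ w) := Iff.rfl

theorem nil_notMem_fSigmaLanguage : [] ∉ fSigmaLanguage := by
  rw [mem_fSigmaLanguage]
  simp [forbiddenWords]

/-- No forbidden word occurs in `σ` from position `N` on. -/
def AvoidsFrom (σ : ℕ → Fin 2) (N : ℕ) : Prop :=
  ∀ p, N ≤ p → ∀ f ∈ forbiddenWords, ¬ OccursAt σ p f

/-- From position `N` on, `σ` is the word `0 1 0 1 ⋯`. -/
def AlternatesFrom (σ : ℕ → Fin 2) (N : ℕ) : Prop :=
  σ N = 0 ∧ ∀ i, N ≤ i → σ (i + 1) ≠ σ i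

section

variable {σ : ℕ → Fin 2}

theorem avoidsFrom_iff {N : ℕ} : AvoidsFrom σ N ↔ ∀ p, N ≤ p →
    ¬ (σ p = 1 ∧ σ (p + 1) = 1) ∧
    ¬ (σ p = 1 ∧ σ (p + 1) = 0 ∧ σ (p + 2) = 0 ∧ σ (p + 3) = 1) ∧
    ¬ (σ p = 0 ∧ σ (p + 1) = 0 ∧ σ (p + 2) = 0 ∧ σ (p + 3) = 0) := by
  simp [AvoidsFrom, forbiddenWords, occursAt_cons, occursAt_nil, add_assoc]

theorem AlternatesFrom.one {N : ℕ} (h : AlternatesFrom σ N) : σ (N + 1) = 1 := by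
  have := h.2 N le_rfl
  rw [h.1] at this
  omega

theorem AlternatesFrom.add_two {N : ℕ} (h : AlternatesFrom σ N) : AlternatesFrom σ (N + 2) := by
  refine ⟨?_, fun i hi => h.2 i (by omega)⟩
  have h1 := h.2 (N + 1) (by omega)
  rw [h.one] at h1
  have : N + 1 + 1 = N + 2 := rfl
  rw [this] at h1
  omega

theorem AlternatesFrom.exists_ge {N : ℕ} (h : AlternatesFrom σ N) (M : ℕ) :
    ∃ N', M ≤ N' ∧ AlternatesFrom σ N' := by
  suffices H : ∀ k, AlternatesFrom σ (N + 2 * k) from ⟨_, by omega, H M⟩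
  intro k
  induction k with
  | zero => exact h
  | succ k ih => exact ih.add_two

theorem AlternatesFrom.step {N : ℕ} (h : AlternatesFrom σ N) :
    factor σ N 2 ∈ fSigmaLanguage ∧ AlternatesFrom σ (N + 2) := by
  refine ⟨mem_fSigmaLanguage.2 (.inr (.inr (.inl ?_))), h.add_two⟩
  simp [factor, List.range_succ, h.1, h.one]

/-- A factor 11 is forbidden, and a factor 00 with its two neighbours gives 000 or the forbidden
1001. The left neighbour must also be past `N`, hence `N + 1`. -/
theorem AvoidsFrom.exists_alternatesFrom {N : ℕ} (h : AvoidsFrom σ N)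
    (h0 : ∀ p, N ≤ p → ¬ (σ p = 0 ∧ σ (p + 1) = 0 ∧ σ (p + 2) = 0)) :
    ∃ M, AlternatesFrom σ M := by
  rw [avoidsFrom_iff] at h
  have halt : ∀ i, N + 1 ≤ i → σ (i + 1) ≠ σ i := by
    intro i hi heq
    obtain ⟨j, rfl⟩ : ∃ j, i = j + 1 := ⟨i - 1, by omega⟩
    have e1 := h (j + 1) (by omega)
    have e2 := h j (by omega)
    have e3 := h0 (j + 1) (by omega)
    have e4 := h0 j (by omega)
    simp only [add_assoc, Nat.reduceAdd] at *
    have := e1.1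
    have := e2.2.1
    omega
  by_cases hz : σ (N + 1) = 0
  · exact ⟨N + 1, hz, halt⟩
  · refine ⟨N + 2, ?_, fun i hi => halt i (by omega)⟩
    have := halt (N + 1) le_rfl
    have e : N + 1 + 1 = N + 2 := rfl
    rw [e] at this
    omega

/-- Once a first word ending in 10 is available, nothing can fail. If 000 recurs, cut each time
inside 1000 as 10|00, using words from 001 to 10. Otherwise the tail alternates, and the word 1
followed by words 01 covers it. -/
theorem mem_omegaPower_fSigmaLanguage_of_start {N B : ℕ} (hσ : AvoidsFrom σ N)
    (hstart : ∀ n, B ≤ n → OccursAt σ n [1, 0] → factor σ 0 (n + 2) ∈ fSigmaLanguage) :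
    σ ∈ omegaPower fSigmaLanguage := by
  by_cases h0 : ∀ M, ∃ p, M ≤ p ∧ σ p = 0 ∧ σ (p + 1) = 0 ∧ σ (p + 2) = 0
  · have hcut : ∀ M, ∃ q, M ≤ q ∧ OccursAt σ q [1, 0] ∧ OccursAt σ (q + 2) [0, 0, 1] := by
      intro M
      obtain ⟨p, hp, h1, h2, h3⟩ := h0 (max M N + 1)
      obtain ⟨q, rfl⟩ : ∃ q, p = q + 1 := ⟨p - 1, by omega⟩
      have hq := (avoidsFrom_iff.1 hσ) q (by omega)
      have hq' := (avoidsFrom_iff.1 hσ) (q + 1) (by omega)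
      refine ⟨q, by omega, ?_, ?_⟩ <;>
      · simp only [occursAt_cons, occursAt_nil, add_assoc, Nat.reduceAdd, and_true] at *
        have := hq.2.2
        have := hq'.2.2
        omega
    refine mem_omegaPower_of_step nil_notMem_fSigmaLanguage
      (fun p => p = 0 ∨ OccursAt σ p [0, 0, 1]) (.inl rfl) ?_
    rintro p (rfl | hp)
    · obtain ⟨q, hq, h1, h2⟩ := hcut B
      exact ⟨q + 2, hstart q hq h1, .inr (by rwa [zero_add])⟩
    · obtain ⟨q, hq, h1, h2⟩ := hcut (p + 2)
      refine ⟨q + 2 - p, mem_fSigmaLanguage.2 (.inr (.inr (.inr ⟨?_, ?_⟩))), .inr ?_⟩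
      · exact hp.isPrefix_factor (by simp; omega)
      · exact h1.isSuffix_factor (by omega) (by simp; omega)
      · rwa [Nat.add_sub_cancel' (by omega)]
  · push Not at h0
    obtain ⟨M, hM⟩ := h0
    obtain ⟨M', hM'⟩ := AvoidsFrom.exists_alternatesFrom (σ := σ) (N := max M N)
      (fun p hp => hσ p (le_trans (le_max_right _ _) hp))
      (fun p hp ⟨h1, h2, h3⟩ => hM p (le_trans (le_max_left _ _) hp) h1 h2 h3)
    obtain ⟨n, hn, ha⟩ := hM'.exists_ge B
    refine mem_omegaPower_of_step nil_notMem_fSigmaLanguage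
      (fun p => p = 0 ∨ (σ p = 1 ∧ AlternatesFrom σ (p + 1)) ∨ AlternatesFrom σ p) (.inl rfl) ?_
    rintro p (rfl | ⟨hp, hp'⟩ | hp)
    · refine ⟨n + 1 + 2, hstart (n + 1) (by omega) ?_, .inr (.inl ?_)⟩
      · simp [occursAt_cons, occursAt_nil, ha.one, ha.add_two.1]
      · have e : 0 + (n + 1 + 2) = n + 2 + 1 := by omega
        rw [e]
        exact ⟨ha.add_two.one, ha.add_two.add_two⟩
    · refine ⟨1, mem_fSigmaLanguage.2 (.inr (.inl ?_)), .inr (.inr hp')⟩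
      simp [factor, hp]
    · exact ⟨2, hp.step.1, .inr (.inr hp.step.2)⟩

theorem mem_omegaPower_fSigmaLanguage_of_not_avoidsFrom (hσ : ¬ AvoidsFrom σ 0) :
    σ ∈ omegaPower fSigmaLanguage := by
  have hbad : ∀ {N}, ¬ AvoidsFrom σ N → ∃ p f, N ≤ p ∧ f ∈ forbiddenWords ∧ OccursAt σ p f := by
    intro N h
    unfold AvoidsFrom at h
    push Not at h
    obtain ⟨p, hp, f, hf, h⟩ := h
    exact ⟨p, f, hp, hf, h⟩
  by_cases hall : ∀ N, ¬ AvoidsFrom σ N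
  · refine mem_omegaPower_of_step nil_notMem_fSigmaLanguage (fun _ => True) trivial fun P _ => ?_
    obtain ⟨p, f, hp, hf, hocc⟩ := hbad (hall P)
    refine ⟨p + f.length - P, mem_fSigmaLanguage.2 (.inl ⟨f, hf, ?_⟩), trivial⟩
    exact hocc.isInfix_factor hp (by omega)
  · push Not at hall
    obtain ⟨N, hN⟩ := hall
    obtain ⟨p, f, -, hf, hocc⟩ := hbad hσ
    exact mem_omegaPower_fSigmaLanguage_of_start (B := p + f.length) hN fun n hn _ =>
      mem_fSigmaLanguage.2 (.inl ⟨f, hf, hocc.isInfix_factor (Nat.zero_le _) (by omega)⟩)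

theorem mem_omegaPower_fSigmaLanguage_of_alternatesFrom {N : ℕ} (h1 : σ 0 = 1)
    (h : AlternatesFrom σ N) : σ ∈ omegaPower fSigmaLanguage := by
  refine mem_omegaPower_of_step nil_notMem_fSigmaLanguage
    (fun p => p = 0 ∨ AlternatesFrom σ p) (.inl rfl) ?_
  rintro p (rfl | hp)
  · refine ⟨N + 2, mem_fSigmaLanguage.2 (.inr (.inl ⟨?_, ?_⟩)), .inr ?_⟩
    · exact (occursAt_singleton.2 h1).isPrefix_factor (by simp)
    · exact (occursAt_singleton.2 h.one).isSuffix_factor (by omega) (by simp)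
    · rw [zero_add]
      exact h.add_two
  · exact ⟨2, hp.step.1, .inr hp.step.2⟩

/-- After a word ending in 1, a word starting with 1 would create 11 and one starting with 001 would
create 1001. So the next word is 01, which ends in 1 again, and this repeats forever. -/
theorem cases_of_mem_omegaPower_fSigmaLanguage (hσ : AvoidsFrom σ 0)
    (h : σ ∈ omegaPower fSigmaLanguage) :
    OccursAt σ 0 [0, 0, 1] ∨ AlternatesFrom σ 0 ∨ (σ 0 = 1 ∧ ∃ N, AlternatesFrom σ N) := by
  obtain ⟨w, n, h0, h⟩ := (mem_omegaPower_iff nil_notMem_fSigmaLanguage).1 h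
  have hw : ∀ i, ([1] <+: w i ∧ [1] <:+ w i) ∨ w i = [0, 1] ∨
      ([0, 0, 1] <+: w i ∧ [1, 0] <:+ w i) := by
    intro i
    refine (mem_fSigmaLanguage.1 (h i).1).resolve_left ?_
    rintro ⟨f, hf, hfw⟩
    obtain ⟨p, -, -, hp⟩ := (h i).2.1.exists_of_isInfix hfw
    exact hσ p (Nat.zero_le _) f hf hp
  have hlast : ∀ i, [1] <:+ w i → ∃ p, p + 1 = n (i + 1) ∧ σ p = 1 := by
    intro i hi
    obtain ⟨p, -, hp, h1⟩ := (h i).2.1.exists_of_isSuffix hi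
    exact ⟨p, by rw [(h i).2.2, ← hp]; rfl, occursAt_singleton.1 h1⟩
  have hnext : ∀ i, [1] <:+ w i → w (i + 1) = [0, 1] := by
    intro i hi
    obtain ⟨p, hp, h1⟩ := hlast i hi
    have hb := avoidsFrom_iff.1 hσ p (Nat.zero_le _)
    have hocc := (h (i + 1)).2.1
    rw [← hp] at hocc
    rcases hw (i + 1) with ⟨h', -⟩ | h' | ⟨h', -⟩
    · exact absurd ⟨h1, occursAt_singleton.1 (hocc.prefix h')⟩ hb.1
    · exact h'
    · have := hocc.prefix h'
      simp only [occursAt_cons, occursAt_nil, add_assoc, Nat.reduceAdd, and_true] at this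
      exact absurd ⟨h1, this⟩ hb.2.1
  have htail : [1] <:+ w 0 → AlternatesFrom σ (n 1) := by
    intro h1
    have hall : ∀ i, w (i + 1) = [0, 1] := by
      intro i
      induction i with
      | zero => exact hnext 0 h1
      | succ i ih => exact hnext _ (by rw [ih]; exact ⟨[0], rfl⟩)
    have hn : ∀ i, n (i + 1) = n 1 + 2 * i := by
      intro i
      induction i with
      | zero => rfl
      | succ i ih => rw [(h (i + 1)).2.2, ih, hall]; simp; omega
    have hval : ∀ i, σ (n 1 + 2 * i) = 0 ∧ σ (n 1 + 2 * i + 1) = 1 := by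
      intro i
      have := (h (i + 1)).2.1
      rw [hall, hn] at this
      simpa [occursAt_cons, occursAt_nil] using this
    refine ⟨(hval 0).1, fun i hi => ?_⟩
    obtain ⟨k, rfl⟩ := Nat.exists_eq_add_of_le hi
    rcases Nat.even_or_odd' k with ⟨j, rfl | rfl⟩
    · rw [(hval j).1, (hval j).2]
      decide
    · have e : n 1 + (2 * j + 1) + 1 = n 1 + 2 * (j + 1) := by omega
      rw [e, ← add_assoc, (hval (j + 1)).1, (hval j).2]
      decide
  have hocc := (h 0).2.1
  rw [h0] at hocc
  rcases hw 0 with ⟨h', h''⟩ | h' | ⟨h', -⟩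
  · exact .inr (.inr ⟨occursAt_singleton.1 (hocc.prefix h'), _, htail h''⟩)
  · have ht := htail (by rw [h']; exact ⟨[0], rfl⟩)
    have hn : n 1 = 2 := by rw [(h 0).2.2, h0, h']; rfl
    rw [hn] at ht
    rw [h'] at hocc
    simp only [occursAt_cons, occursAt_nil, and_true, zero_add] at hocc
    refine .inr (.inl ⟨hocc.1, fun i _ => ?_⟩)
    rcases i with _ | _ | i
    · rw [hocc.1, zero_add, hocc.2]
      decide
    · rw [zero_add, hocc.2]
      have := ht.1
      simp [this]
    · exact ht.2 _ (by omega)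
  · exact .inl (hocc.prefix h')

end

/-- Every sequence with a forbidden word, or starting with 001, belongs to the ω-power. These are
open conditions; what remains is a countable union of closed alternation conditions. -/
theorem isSigma0_two_omegaPower_fSigmaLanguage : IsSigma0 2 (omegaPower fSigmaLanguage) := by
  have h12 : (1 : Ordinal.{0}) < 2 := by exact_mod_cast one_lt_two
  have hopen : ∀ {U : Set (ℕ → Fin 2)}, IsOpen U → IsSigma0 2 U := fun hU => hU.isSigma0 h12.le
  have hclosed : ∀ {F : Set (ℕ → Fin 2)}, IsClosed F → IsSigma0 2 F := fun hF =>
    ((isPi0_one_iff _).2 hF).isSigma0_of_lt le_rfl h12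
  have halt : ∀ N, IsClosed {σ : ℕ → Fin 2 | AlternatesFrom σ N} := by
    intro N
    have : {σ : ℕ → Fin 2 | AlternatesFrom σ N} = {σ | OccursAt σ N [0]} ∩
        ⋂ i, ⋂ _ : N ≤ i, ({σ | OccursAt σ i [0, 0]} ∪ {σ | OccursAt σ i [1, 1]})ᶜ := by
      ext σ
      simp only [AlternatesFrom, occursAt_cons, occursAt_nil, Set.mem_inter_iff, Set.mem_iInter,
        Set.mem_compl_iff, Set.mem_union, Set.mem_ofPred_eq, and_true]
      exact and_congr Iff.rfl (forall₂_congr fun i _ => by omega)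
    rw [this]
    refine (isClopen_occursAt _ _).1.inter (isClosed_iInter fun i => isClosed_iInter fun _ => ?_)
    exact ((isClopen_occursAt _ _).union (isClopen_occursAt _ _)).2.isClosed_compl
  have hbad : IsOpen {σ : ℕ → Fin 2 | ¬ AvoidsFrom σ 0} := by
    have : {σ : ℕ → Fin 2 | ¬ AvoidsFrom σ 0} =
        ⋃ p, ⋃ f ∈ forbiddenWords, {σ | OccursAt σ p f} := by
      ext σ
      simp [AvoidsFrom]
    rw [this]
    exact isOpen_iUnion fun p => isOpen_biUnion fun f _ => (isClopen_occursAt _ _).2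
  have : omegaPower fSigmaLanguage = ({σ | ¬ AvoidsFrom σ 0} ∪ {σ | OccursAt σ 0 [0, 0, 1]}) ∪
      ({σ | AlternatesFrom σ 0} ∪ ⋃ N, ({σ | OccursAt σ 0 [1]} ∩ {σ | AlternatesFrom σ N})) := by
    ext σ
    simp only [Set.mem_union, Set.mem_iUnion, Set.mem_inter_iff, Set.mem_ofPred_eq,
      exists_and_left, occursAt_singleton]
    constructor
    · intro h
      by_cases hp : AvoidsFrom σ 0
      · have := cases_of_mem_omegaPower_fSigmaLanguage hp h
        tauto
      · exact .inl (.inl hp)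
    · rintro ((h | h) | h | ⟨h1, N, h⟩)
      · exact mem_omegaPower_fSigmaLanguage_of_not_avoidsFrom h
      · by_cases hp : AvoidsFrom σ 0
        · refine mem_omegaPower_fSigmaLanguage_of_start (B := 2) hp fun n hn hocc =>
            mem_fSigmaLanguage.2 (.inr (.inr (.inr ⟨?_, ?_⟩)))
          · exact h.isPrefix_factor (by simp; omega)
          · exact hocc.isSuffix_factor (by omega) (by simp)
        · exact mem_omegaPower_fSigmaLanguage_of_not_avoidsFrom hp
      · exact mem_omegaPower_of_step nil_notMem_fSigmaLanguage (AlternatesFrom σ) h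
          fun p hp => ⟨2, hp.step⟩
      · exact mem_omegaPower_fSigmaLanguage_of_alternatesFrom h1 h
  rw [this]
  refine ((hopen hbad).union (hopen (isClopen_occursAt _ _).2)).union
    ((hclosed (halt 0)).union (.iUnion_mem h12.le fun N => ?_))
  exact (hclosed (isClopen_occursAt _ _).1).inter (hclosed (halt N))

/-! ### Hardness for Σ⁰_2 by guessing an index -/

section Hardness

variable {Y : Type}

open Classical in
/-- The least index, among those not yet refuted by the first `k` letters of `x`, of a set
`F n` that may contain `x`, as long as the indices are tried one per letter. -/
noncomputable def guessIndex (F : ℕ → Set (ℕ → Y)) (x : ℕ → Y) : ℕ → ℕ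
  | 0 => 0
  | k + 1 => if (agreeSet x (k + 1) ∩ F (guessIndex F x k)).Nonempty then guessIndex F x k
      else guessIndex F x k + 1

open Classical in
/-- The sequence of the blocks `1 0 1 0` and `1 0 0 0`, the latter when the guess changes. -/
noncomputable def guessCode (F : ℕ → Set (ℕ → Y)) (x : ℕ → Y) (i : ℕ) : Fin 2 :=
  if i % 4 = 0 ∨ (i % 4 = 2 ∧ guessIndex F x (i / 4 + 1) = guessIndex F x (i / 4)) then 1 else 0

theorem guessIndex_congr (F : ℕ → Set (ℕ → Y)) {x x' : ℕ → Y} {k : ℕ}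
    (h : ∀ i < k, x i = x' i) : guessIndex F x k = guessIndex F x' k := by
  induction k with
  | zero => rfl
  | succ k ih => rw [guessIndex, guessIndex, ih fun i hi => h i (by omega), agreeSet_congr h]

/-- The guess never passes an n with `x ∈ F n`, because that n is never refuted. Conversely, a
stable guess is never refuted, so `x` is in the corresponding closed set. -/
theorem exists_guessIndex_stable_iff [TopologicalSpace Y] {F : ℕ → Set (ℕ → Y)}
    (hF : ∀ n, IsClosed (F n)) (x : ℕ → Y) : x ∈ ⋃ n, F n ↔
      ∃ k₀, ∀ k, k₀ ≤ k → guessIndex F x (k + 1) = guessIndex F x k := by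
  have hmono : Monotone (guessIndex F x) := monotone_nat_of_le_succ fun k => by
    rw [guessIndex]
    split_ifs <;> omega
  constructor
  · intro hx
    obtain ⟨n, hn⟩ := Set.mem_iUnion.1 hx
    have hle : ∀ k, guessIndex F x k ≤ n := by
      intro k
      induction k with
      | zero => exact Nat.zero_le _
      | succ k ih =>
        rw [guessIndex]
        split_ifs with h
        · exact ih
        · refine Nat.succ_le_of_lt (lt_of_le_of_ne ih fun heq => h ⟨x, fun _ _ => rfl, ?_⟩)
          rwa [heq]
    obtain ⟨k₀, hk₀⟩ : ∃ k₀, ∀ k, guessIndex F x k ≤ guessIndex F x k₀ := by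
      have hfin : (Set.range (guessIndex F x)).Finite :=
        (Set.finite_Iic n).subset (by rintro _ ⟨k, rfl⟩; exact hle k)
      obtain ⟨_, ⟨⟨k₀, rfl⟩, hmax⟩⟩ := hfin.exists_maximal (Set.range_nonempty _)
      exact ⟨k₀, fun k => (le_total _ _).elim id fun h => hmax ⟨k, rfl⟩ h⟩
    exact ⟨k₀, fun k hk => le_antisymm ((hk₀ _).trans (hmono hk)) (hmono (Nat.le_succ k))⟩
  · rintro ⟨k₀, hk₀⟩
    have hconst : ∀ k, k₀ ≤ k → guessIndex F x k = guessIndex F x k₀ := by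
      intro k hk
      induction hk with
      | refl => rfl
      | step hk ih => rw [hk₀ _ hk, ih]
    refine Set.mem_iUnion.2 ⟨guessIndex F x k₀, ?_⟩
    by_contra hx
    obtain ⟨n, hn⟩ := exists_agreeSet_subset (hF _).isOpen_compl hx
    have h := hk₀ (max n k₀) (le_max_right _ _)
    rw [guessIndex] at h
    split_ifs at h with hne
    · obtain ⟨z, hz, hzF⟩ := hne
      rw [hconst _ (le_max_right _ _)] at hzF
      exact hn (fun i hi => hz i (by omega)) hzF
    · omega

theorem continuous_guessCode [TopologicalSpace Y] [DiscreteTopology Y] (F : ℕ → Set (ℕ → Y)) :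
    Continuous (guessCode F) := by
  refine continuous_of_agree fun i => ⟨i / 4 + 1, fun x x' h => ?_⟩
  have h' : guessIndex F x (i / 4) = guessIndex F x' (i / 4) :=
    guessIndex_congr F fun j hj => h j (by omega)
  simp only [guessCode, guessIndex_congr F h, h']

theorem guessCode_eq_one {F : ℕ → Set (ℕ → Y)} {x : ℕ → Y} {i : ℕ} : guessCode F x i = 1 ↔
    i % 4 = 0 ∨ (i % 4 = 2 ∧ guessIndex F x (i / 4 + 1) = guessIndex F x (i / 4)) := by
  unfold guessCode
  split_ifs with h
  · exact iff_of_true rfl h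
  · exact iff_of_false zero_ne_one h

/-- Ones occur only at even positions, and at every multiple of 4. -/
theorem avoidsFrom_guessCode (F : ℕ → Set (ℕ → Y)) (x : ℕ → Y) :
    AvoidsFrom (guessCode F x) 0 := by
  have h0 : ∀ i, guessCode F x i = 0 → i % 4 ≠ 0 := fun i h h' => by
    rw [guessCode_eq_one.2 (.inl h')] at h
    exact one_ne_zero h
  have h1 : ∀ i, guessCode F x i = 1 → i % 2 = 0 := fun i h => by
    rcases guessCode_eq_one.1 h with h | h <;> omega
  refine avoidsFrom_iff.2 fun p _ => ⟨?_, ?_, ?_⟩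
  · rintro ⟨a, b⟩
    have := h1 _ a
    have := h1 _ b
    omega
  · rintro ⟨a, -, -, b⟩
    have := h1 _ a
    have := h1 _ b
    omega
  · rintro ⟨a, b, c, d⟩
    have := h0 _ a
    have := h0 _ b
    have := h0 _ c
    have := h0 _ d
    omega

/-- The code starts with 1, so membership means eventual alternation, that is, a 1 at position 4k +
2 for all large k. -/
theorem guessCode_mem_iff (F : ℕ → Set (ℕ → Y)) (x : ℕ → Y) :
    guessCode F x ∈ omegaPower fSigmaLanguage ↔
      ∃ k₀, ∀ k, k₀ ≤ k → guessIndex F x (k + 1) = guessIndex F x k := by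
  have h1 : guessCode F x 0 = 1 := guessCode_eq_one.2 (.inl rfl)
  have hodd : ∀ i, i % 2 = 1 → guessCode F x i = 0 := by
    intro i hi
    by_contra h
    have : guessCode F x i = 1 := by omega
    rcases guessCode_eq_one.1 this with h | h <;> omega
  constructor
  · intro h
    rcases cases_of_mem_omegaPower_fSigmaLanguage (avoidsFrom_guessCode F x) h with
      h | h | ⟨-, N, h⟩
    · rw [occursAt_cons, h1] at h
      exact absurd h.1 one_ne_zero
    · exact absurd (h1.symm.trans h.1) one_ne_zero
    · refine ⟨N, fun k hk => ?_⟩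
      have h2 := h.2 (4 * k + 1) (by omega)
      rw [hodd (4 * k + 1) (by omega)] at h2
      have h3 : guessCode F x (4 * k + 1 + 1) = 1 := by omega
      rcases guessCode_eq_one.1 h3 with h | ⟨-, h⟩
      · omega
      · rwa [show (4 * k + 1 + 1) / 4 = k by omega] at h
  · rintro ⟨k₀, hk₀⟩
    refine mem_omegaPower_fSigmaLanguage_of_alternatesFrom (N := 4 * k₀ + 1) h1
      ⟨hodd _ (by omega), fun i hi => ?_⟩
    have heven : ∀ j, 4 * k₀ ≤ j → j % 2 = 0 → guessCode F x j = 1 := fun j hj hj2 => by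
      refine guessCode_eq_one.2 ?_
      by_cases h4 : j % 4 = 0
      · exact .inl h4
      · exact .inr ⟨by omega, hk₀ _ (by omega)⟩
    rcases Nat.mod_two_eq_zero_or_one i with hi2 | hi2
    · rw [heven i (by omega) hi2, hodd (i + 1) (by omega)]
      exact zero_ne_one
    · rw [heven (i + 1) (by omega) (by omega), hodd i hi2]
      exact one_ne_zero

end Hardness

theorem isCompleteFor_omegaPower_fSigmaLanguage :
    IsCompleteFor (fun X _ => IsSigma0 (X := X) 2) (omegaPower fSigmaLanguage) := by
  refine ⟨isSigma0_two_omegaPower_fSigmaLanguage, fun Y _ _ _ A hA => ?_⟩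
  obtain ⟨γ, F, hF, rfl⟩ := (isSigma0_iff le_rfl _).1 hA
  have hcl : ∀ n, IsClosed (F n) := by
    intro n
    obtain ⟨h1, h2, h⟩ := hF n
    have : γ n = 1 := (Ordinal.eq_one_or_two_le h1).resolve_right (not_le.2 h2)
    rw [this] at h
    exact (isPi0_one_iff _).1 h
  refine ⟨guessCode F, continuous_guessCode F, ?_⟩
  ext x
  rw [Set.mem_preimage, guessCode_mem_iff, exists_guessIndex_stable_iff hcl]

end LevelTwo

theorem theorem4p1 (ξ : Ordinal.{0}) (h1 : 1 ≤ ξ) (hξ : ξ.card ≤ Cardinal.aleph0) :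
    (∃ P : Language (Fin 2), IsCompleteFor (fun X _ => IsPi0 (X := X) ξ) (omegaPower P)) ∧
    (∃ S : Language (Fin 2), IsCompleteFor (fun X _ => IsSigma0 (X := X) ξ) (omegaPower S)) := by
  obtain ⟨C, hC⟩ := exists_isCompleteFor_pi0 ξ h1 hξ
  constructor
  · rcases Ordinal.eq_one_or_two_le h1 with rfl | h2
    · exact ⟨{[0]}, by rw [omegaPower_singleton_zero]; exact isCompleteFor_pi0_one⟩
    · obtain ⟨L, hL, hred⟩ := exists_omegaPower_pi0 h2 hC.1
      exact ⟨L, hC.of_reducible hL hred⟩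
  · rcases Ordinal.eq_one_or_two_le h1 with rfl | h2
    · exact ⟨_, isCompleteFor_omegaPower_openLanguage⟩
    · rcases h2.eq_or_lt with rfl | h3
      · exact ⟨_, isCompleteFor_omegaPower_fSigmaLanguage⟩
      · obtain ⟨L, hL, hred⟩ := exists_omegaPower_sigma0 h3 hC.compl_pi0.1
        exact ⟨L, hC.compl_pi0.of_reducible hL hred⟩
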